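/- Let $p$ be a prime and let $(K,\nu)$ be a henselian valued field (Krull valuation of arbitrary rank, written additively) with $\operatorname{char} K=0$ and residue field $K\nu$ of characteristic $p$. Extend $\nu$ to the algebraic closure $K^{\mathrm{ac}}$, and suppose that $K$ contains a primitive $p$-th root of unity. Let $n\ge 1$ and let $\theta\in K^{\mathrm{ac}}$ have minimal polynomial $X^{p^n}-a$ over $K$ for some $a\in K$, with $\nu\theta=0$. Put $\nu(\theta-K)=\{\nu(\theta-c)\mid c\in K\}$. For an algebraic extension $L|K$ inside $K^{\mathrm{ac}}$, let $\nu L$ and $L\nu$ be the value group and the residue field of $L$. A finite extension $L|K$ is called *defectless* if $[L:K]=[\nu L:\nu K]\,[L\nu:K\nu]$. An algebraic extension $L|K$ is called *unramified* if $\nu L=\nu K$ and, for every finite subextension $E|K$, $p\nmid[\nu E:\nu K]$ and $E\nu|K\nu$ is separable; it is called *purely wild* if $\nu L/\nu K$ is a $p$-group and $L\nu|K\nu$ is purely inseparable. A *maximal purely wild extension* of $K$ is a purely wild extension that is not properly contained in another one. A *Kummer extension* of $K$ is a Galois extension of degree $p$ generated by an element whose minimal polynomial over $K$ has the form $X^p-b$.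 A field $k$ of characteristic $p$ is *Artin–Schreier closed* if no polynomial $X^p-X-b$ with $b\in k$ is irreducible over $k$. Then: (I) $\gamma\le\frac{\nu p}{p-1}$ for all $\gamma\in\nu(\theta-K)$. (II) $\frac{\nu p}{p-1}\in\nu(\theta-K)$ if and only if $K(\theta)|K$ is a defectless and unramified Kummer extension. (III) If $K(\theta)|K$ is purely wild and $K\nu$ is not Artin–Schreier closed, then maximal purely wild extensions of $K$ are not unique: there exist two maximal purely wild extensions of $K$ that are not isomorphic over $K$. -/

import Mathlib

/-!
Throughout, `K` is a field, `Ω` an algebraic closure of `K`, and `v` a valuation on `Ω`, written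
multiplicatively: the additive relation `ν x ≤ ν y` reads `v y ≤ v x`, and `ν x = 0` reads
`v x = 1`. Every algebraic extension of `K` is seen as an intermediate field `L` of `Ω | K`, and it
carries the restriction of `v`; the field `K` itself is the intermediate field `⊥`.
-/

namespace PurelyWild

open Polynomial

section Valued

variable {K Ω Γ : Type*} [Field K] [Field Ω] [Algebra K Ω]
  [LinearOrderedCommGroupWithZero Γ]

/-- The restriction of `v` to `K` is henselian: its valuation ring is a henselian local ring. -/
def IsHenselianOn (K : Type*) {Ω Γ : Type*} [Field K] [Field Ω] [Algebra K Ω]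
    [LinearOrderedCommGroupWithZero Γ] (v : Valuation Ω Γ) : Prop :=
  HenselianLocalRing (v.comap (algebraMap K Ω)).valuationSubring

/-- The value group of `L`: all values of nonzero elements of `L`. -/
def valueGroup (v : Valuation Ω Γ) (L : IntermediateField K Ω) : Subgroup Γˣ where
  carrier := {γ | ∃ x ∈ L, v x = γ}
  one_mem' := ⟨1, L.one_mem, by simp⟩
  mul_mem' := by
    rintro a b ⟨x, hx, hxa⟩ ⟨y, hy, hyb⟩
    exact ⟨x * y, L.mul_mem hx hy, by simp [hxa, hyb]⟩
  inv_mem' := by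
    rintro a ⟨x, hx, hxa⟩
    exact ⟨x⁻¹, L.inv_mem hx, by simp [hxa]⟩

/-- The residue field of `L`, as a subfield of the residue field of `Ω`: all residues of those
elements of `L` that lie in the valuation ring. -/
def residueField (v : Valuation Ω Γ) (L : IntermediateField K Ω) :
    Subfield (IsLocalRing.ResidueField v.valuationSubring) where
  carrier := {r | ∃ x : v.valuationSubring, (x : Ω) ∈ L ∧ IsLocalRing.residue _ x = r}
  one_mem' := ⟨1, L.one_mem, map_one _⟩
  zero_mem' := ⟨0, L.zero_mem, map_zero _⟩
  mul_mem' := by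
    rintro a b ⟨x, hx, rfl⟩ ⟨y, hy, rfl⟩
    exact ⟨x * y, L.mul_mem hx hy, map_mul _ _ _⟩
  add_mem' := by
    rintro a b ⟨x, hx, rfl⟩ ⟨y, hy, rfl⟩
    exact ⟨x + y, L.add_mem hx hy, map_add _ _ _⟩
  neg_mem' := by
    rintro a ⟨x, hx, rfl⟩
    exact ⟨-x, L.neg_mem hx, map_neg _ _⟩
  inv_mem' := by
    rintro a ⟨x, hx, rfl⟩
    by_cases h : IsUnit x
    · obtain ⟨u, rfl⟩ := h
      refine ⟨(u⁻¹ : (v.valuationSubring)ˣ), ?_, ?_⟩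
      · have h1 : ((u : v.valuationSubring) : Ω) * ((u⁻¹ : (v.valuationSubring)ˣ) : _) = 1 := by
          exact_mod_cast congrArg Subtype.val u.mul_inv
        rw [← inv_eq_of_mul_eq_one_right h1]
        exact L.inv_mem hx
      · exact eq_inv_of_mul_eq_one_left (by rw [← map_mul, u.inv_mul, map_one])
    · refine ⟨0, L.zero_mem, ?_⟩
      have h0 : IsLocalRing.residue v.valuationSubring x = 0 :=
        (IsLocalRing.residue_eq_zero_iff x).2 h
      rw [h0, map_zero, inv_zero]

theorem residueField_bot_le (v : Valuation Ω Γ) (L : IntermediateField K Ω) :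
    residueField v (⊥ : IntermediateField K Ω) ≤ residueField v L := by
  rintro r ⟨x, hx, rfl⟩
  exact ⟨x, bot_le (a := L) hx, rfl⟩

/-- The residue field extension of `L | K`: the residue field of `L` as a field extension of the
residue field of `K`. -/
noncomputable def residueExtension (v : Valuation Ω Γ) (L : IntermediateField K Ω) :
    IntermediateField (residueField v (⊥ : IntermediateField K Ω))
      (IsLocalRing.ResidueField v.valuationSubring) :=
  Subfield.extendScalars (residueField_bot_le v L)

/-- The ramification index of `L | K`: the index of the value group of `K` in that of `L`. -/
noncomputable def ramificationIndex (v : Valuation Ω Γ) (L : IntermediateField K Ω) : ℕ :=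
  (valueGroup v (⊥ : IntermediateField K Ω)).relIndex (valueGroup v L)

/-- The degree of the residue field extension of `L | K`. -/
noncomputable def residueDegree (v : Valuation Ω Γ) (L : IntermediateField K Ω) : ℕ :=
  Module.finrank (residueField v (⊥ : IntermediateField K Ω)) (residueExtension v L)

/-- A finite extension `L | K` is defectless if its degree is the product of the ramification index
and the residue degree. -/
def IsDefectless (v : Valuation Ω Γ) (L : IntermediateField K Ω) : Prop :=
  FiniteDimensional K L ∧ Module.finrank K L = ramificationIndex v L * residueDegree v L

/-- `L | K` is tamely ramified, where `p` is the residue characteristic: for every finite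
subextension `E | K`, the ramification index is not divisible by `p` and the residue field extension
is separable. -/
def IsTamelyRamified (p : ℕ) (v : Valuation Ω Γ) (L : IntermediateField K Ω) : Prop :=
  ∀ E : IntermediateField K Ω, E ≤ L → FiniteDimensional K E →
    ¬ p ∣ ramificationIndex v E ∧
      Algebra.IsSeparable (residueField v (⊥ : IntermediateField K Ω)) (residueExtension v E)

/-- `L | K` is unramified: it is tamely ramified and the value groups of `L` and `K` coincide. -/
def IsUnramified (p : ℕ) (v : Valuation Ω Γ) (L : IntermediateField K Ω) : Prop :=
  IsTamelyRamified p v L ∧ valueGroup v L = valueGroup v (⊥ : IntermediateField K Ω)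

/-- `L | K` is purely wild, where `p` is the residue characteristic: the quotient of the value group
of `L` by that of `K` is a `p`-group, and the residue field extension is purely inseparable. -/
def IsPurelyWild (p : ℕ) (v : Valuation Ω Γ) (L : IntermediateField K Ω) : Prop :=
  IsPGroup p
      (valueGroup v L ⧸ (valueGroup v (⊥ : IntermediateField K Ω)).subgroupOf (valueGroup v L)) ∧
    IsPurelyInseparable (residueField v (⊥ : IntermediateField K Ω)) (residueExtension v L)

/-- `L | K` is a maximal purely wild extension: it is purely wild and no strictly larger algebraic
extension of `K` is purely wild. -/
def IsMaximalPurelyWild (p : ℕ) (v : Valuation Ω Γ) (L : IntermediateField K Ω) : Prop :=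
  Maximal (IsPurelyWild p v) L

/-- The set `ν(θ - K)` of all values `ν(θ - c)` with `c` in `K`. -/
def valueSet (K : Type*) {Ω Γ : Type*} [Field K] [Field Ω] [Algebra K Ω]
    [LinearOrderedCommGroupWithZero Γ] (v : Valuation Ω Γ) (θ : Ω) : Set Γ :=
  Set.range fun c : K => v (θ - algebraMap K Ω c)

/-- `L | K` is a Kummer extension (of degree `p`): a Galois extension of degree `p` generated by an
element whose minimal polynomial over `K` is of the form `X ^ p - a`. -/
def IsKummer (p : ℕ) (L : IntermediateField K Ω) : Prop :=
  IsGalois K L ∧ Module.finrank K L = p ∧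
    ∃ (η : Ω) (a : K), L = IntermediateField.adjoin K {η} ∧ minpoly K η = X ^ p - C a

end Valued

/-- A field `k` (of characteristic `p`) is Artin-Schreier closed if no polynomial `X ^ p - X - a`
with `a` in `k` is irreducible over `k`. -/
def IsArtinSchreierClosed (p : ℕ) (k : Type*) [Field k] : Prop :=
  ∀ a : k, ¬ Irreducible (X ^ p - X - C a : k[X])

end PurelyWild

/-! Put π = ζ - 1 and δ = v π, for a primitive p-th root of unity ζ in K. The congruence p ≡
-π^(p-1) gives δ^(p-1) = v p (`valuation_root_sub_one_pow`). Since v is invariant under conjugation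
(`IsHenselianOn.valuation_algEquiv`), θ - c and ζθ - c have the same value; they differ by πθ, so no
c in K is closer to θ than δ.

The substitution X = 1 + πY turns a Kummer equation into an Artin-Schreier equation modulo the
maximal ideal (`exists_polynomial_one_add_root_sub_one_mul_pow`). A Kummer generator within δ of K
thus yields an integral Y whose residue has the p conjugates Y + i, and the extension is unramified
and defectless. For n ≥ 2 no c is within δ: otherwise the Kummer generator θ^(p^(n-1)) would be
within δ^p < δ of K. Conversely, if a Kummer generator is farther than δ from K, Dedekind
independence and a Lagrange resolvent show that σ acts trivially on residues; norms then behave like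
p-th powers and the extension is purely wild, which a nontrivial unramified defectless extension
never is.

For (III), pass to θ^(p^(n-1)), so that n = 1. An irreducible residual Artin-Schreier polynomial
lifts to η = 1 + πy with η^p in K, and no purely wild extension contains η. Multiplying by η moves θ
by at most δ, so θη is still farther than δ from K and generates a purely wild extension too. Take
maximal ones containing θ and θη respectively: an isomorphism would put θ, hence η, into the second.
-/

namespace PurelyWild

open Polynomial IntermediateField

/-! ### Residues and units in terms of values -/

section Basic

variable {F Γ : Type*} [Field F] [LinearOrderedCommGroupWithZero Γ]

theorem mem_maximalIdeal_iff_valuation_lt_one (w : Valuation F Γ) (x : w.valuationSubring) :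
    x ∈ IsLocalRing.maximalIdeal w.valuationSubring ↔ w x < 1 := by
  rw [ValuationSubring.valuation_lt_one_iff,
    (w.isEquiv_valuation_valuationSubring).lt_one_iff_lt_one]

theorem residue_eq_zero_iff_valuation_lt_one (w : Valuation F Γ) (x : w.valuationSubring) :
    IsLocalRing.residue w.valuationSubring x = 0 ↔ w x < 1 := by
  rw [IsLocalRing.residue_eq_zero_iff, mem_maximalIdeal_iff_valuation_lt_one]

theorem residue_eq_iff_valuation_sub_lt_one (w : Valuation F Γ) (x y : w.valuationSubring) :
    IsLocalRing.residue w.valuationSubring x = IsLocalRing.residue w.valuationSubring y ↔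
      w ((x : F) - y) < 1 := by
  rw [← sub_eq_zero, ← map_sub, residue_eq_zero_iff_valuation_lt_one]
  rfl

theorem isUnit_iff_valuation_eq_one (w : Valuation F Γ) (x : w.valuationSubring) :
    IsUnit x ↔ w x = 1 := by
  have hx : w x ≤ 1 := x.2
  rw [← not_iff_not, ← mem_nonunits_iff, ← IsLocalRing.mem_maximalIdeal,
    mem_maximalIdeal_iff_valuation_lt_one]
  exact hx.lt_iff_ne

theorem valuation_natCast_le_one (w : Valuation F Γ) (m : ℕ) : w (m : F) ≤ 1 :=
  natCast_mem w.valuationSubring m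

end Basic

/-! ### Hensel's lemma and integrality of coefficients -/

section Henselian

variable {K Ω Γ : Type*} [Field K] [Field Ω] [Algebra K Ω]
  [LinearOrderedCommGroupWithZero Γ] {v : Valuation Ω Γ}

/-- Hensel's lemma for simple residual roots, in terms of the values of the coefficients. -/
theorem IsHenselianOn.exists_root (hens : IsHenselianOn K v) {f : K[X]} (hf : f.Monic)
    (hint : ∀ i, v (algebraMap K Ω (f.coeff i)) ≤ 1) {c : K} (hc : v (algebraMap K Ω c) ≤ 1)
    (h0 : v (algebraMap K Ω (f.eval c)) < 1)
    (h1 : v (algebraMap K Ω (f.derivative.eval c)) = 1) : ∃ d : K, f.eval d = 0 := by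
  set w := v.comap (algebraMap K Ω) with hw
  have hl : f ∈ lifts w.valuationSubring.subtype :=
    (lifts_iff_coeff_lifts f).2 fun i => ⟨⟨f.coeff i, hint i⟩, rfl⟩
  obtain ⟨g, rfl, -, hg⟩ := lifts_and_natDegree_eq_and_monic hl hf
  have hev (q : w.valuationSubring[X]) (x : w.valuationSubring) :
      (q.map w.valuationSubring.subtype).eval (x : K) = (q.eval x : w.valuationSubring) :=
    eval_map_apply (f := w.valuationSubring.subtype) x
  let c' : w.valuationSubring := ⟨c, hc⟩
  obtain ⟨d, hd, -⟩ := HenselianLocalRing.is_henselian (self := hens) g hg c'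
    ((mem_maximalIdeal_iff_valuation_lt_one w _).2 (by rw [← hev]; exact h0))
    ((isUnit_iff_valuation_eq_one w _).2 (by rw [← hev, ← derivative_map]; exact h1))
  exact ⟨d, by rw [hev, hd.eq_zero]; rfl⟩

theorem valuation_coeff_prod_X_sub_C_le_one (v : Valuation Ω Γ) (s : Multiset Ω)
    (hs : ∀ x ∈ s, v x ≤ 1) (i : ℕ) : v ((s.map fun x => X - C x).prod.coeff i) ≤ 1 := by
  induction s using Multiset.induction_on generalizing i with
  | empty =>
    rw [Multiset.map_zero, Multiset.prod_zero, coeff_one]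
    split_ifs <;> simp
  | cons a s ih =>
    have ih' := ih fun x hx => hs x (Multiset.mem_cons_of_mem hx)
    have ha := hs a (Multiset.mem_cons_self a s)
    have hC (j : ℕ) : v (a * (s.map fun x => X - C x).prod.coeff j) ≤ 1 := by
      rw [map_mul]; exact mul_le_one' ha (ih' j)
    rw [Multiset.map_cons, Multiset.prod_cons, sub_mul, coeff_sub, coeff_C_mul]
    cases i with
    | zero => simpa using hC 0
    | succ i => rw [coeff_X_mul]; exact v.map_sub_le (ih' i) (hC _)

end Henselian

/-! ### Invariance of the valuation under conjugation -/

section Conjugates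

variable {K Ω : Type*} [Field K] [Field Ω] [Algebra K Ω] [IsAlgClosure K Ω]

theorem isIntegral_of_isAlgClosure (x : Ω) : IsIntegral K x :=
  (IsAlgClosure.isAlgebraic (R := K) (K := Ω)).isAlgebraic x |>.isIntegral

theorem exists_algEquiv_of_aeval_minpoly {x y : Ω} (h : aeval y (minpoly K x) = 0) :
    ∃ σ : Ω ≃ₐ[K] Ω, σ x = y :=
  have := IsAlgClosure.normal K Ω
  minpoly.exists_algEquiv_of_root' (isIntegral_of_isAlgClosure x).isAlgebraic h

variable {Γ : Type*} [CharZero K] [LinearOrderedCommGroupWithZero Γ] {v : Valuation Ω Γ}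

/-- An element of value one whose other conjugates have value less than one, and which is
congruent to one, lies in the base field. -/
theorem IsHenselianOn.mem_range_of_dominant (hens : IsHenselianOn K v) {γ : Ω}
    (h1 : v (1 - γ) < 1) (hconj : ∀ y, aeval y (minpoly K γ) = 0 → y ≠ γ → v y < 1) :
    γ ∈ (algebraMap K Ω).range := by
  have := IsAlgClosure.isAlgClosed K (K := Ω)
  have hγi := isIntegral_of_isAlgClosure (K := K) γ
  have hγ : v γ = 1 := by
    have := v.map_sub_eq_of_lt_left (x := 1) (y := 1 - γ) (by rwa [map_one])
    rwa [sub_sub_cancel, map_one] at this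
  set f := minpoly K γ
  have hfm : f.Monic := minpoly.monic hγi
  have hsep : (f.map (algebraMap K Ω)).Separable := (minpoly.irreducible hγi).separable.map
  have hsplit : f.map (algebraMap K Ω) =
      ((f.map (algebraMap K Ω)).roots.map fun x => X - C x).prod := by
    rw [← Splits.eq_prod_roots_of_monic (IsAlgClosed.splits _) (hfm.map _)]
  have hroot {y : Ω} (hy : y ∈ (f.map (algebraMap K Ω)).roots) : aeval y f = 0 := by
    have := (mem_roots'.1 hy).2
    rwa [IsRoot, eval_map_algebraMap] at this
  have hle {y : Ω} (hy : y ∈ (f.map (algebraMap K Ω)).roots) : v y ≤ 1 := by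
    by_cases h : y = γ
    · rw [h, hγ]
    · exact (hconj y (hroot hy) h).le
  have hmem : γ ∈ (f.map (algebraMap K Ω)).roots := by
    rw [mem_roots', IsRoot, eval_map_algebraMap]
    exact ⟨(hfm.map _).ne_zero, minpoly.aeval K γ⟩
  obtain ⟨s, hs⟩ := Multiset.exists_cons_of_mem hmem
  have hnd : (γ ::ₘ s).Nodup := hs ▸ nodup_roots hsep
  have hγs : γ ∉ s := (Multiset.nodup_cons.1 hnd).1
  have hlt {y : Ω} (hy : y ∈ s) : v y < 1 :=
    hconj y (hroot (hs ▸ Multiset.mem_cons_of_mem hy)) fun h => hγs (h ▸ hy)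
  set g : Polynomial Ω := (s.map fun x => X - C x).prod with hgdef
  have hfac : f.map (algebraMap K Ω) = (X - C γ) * g := by
    rw [hsplit, hs, Multiset.map_cons, Multiset.prod_cons]
  have hg1 : v (g.eval 1) = 1 := by
    rw [hgdef, eval_multiset_prod, Multiset.map_map, map_multiset_prod, Multiset.map_map]
    refine Multiset.prod_eq_one fun z hz => ?_
    obtain ⟨y, hy, rfl⟩ := Multiset.mem_map.1 hz
    simp only [Function.comp_apply, eval_sub, eval_X, eval_C]
    rw [v.map_sub_eq_of_lt_left (by rw [map_one]; exact hlt hy), map_one]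
  have hgint : ∀ i, v (g.coeff i) ≤ 1 :=
    valuation_coeff_prod_X_sub_C_le_one v s fun x hx => (hlt hx).le
  have hg'1 : v (g.derivative.eval 1) ≤ 1 := by
    rw [eval_eq_sum_range]
    refine v.map_sum_le fun i _ => ?_
    rw [one_pow, mul_one, coeff_derivative, map_mul]
    exact mul_le_one' (hgint _) (by exact_mod_cast valuation_natCast_le_one v (i + 1))
  have hevf (q : K[X]) : algebraMap K Ω (q.eval 1) = (q.map (algebraMap K Ω)).eval 1 := by
    rw [← map_one (algebraMap K Ω), eval_map_apply]
  -- Residually `f` is (X - 1) times a power of X, so 1 is a simple root: f'(1) = g(1) + (1 - γ)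
  -- g'(1), where g(1) is a unit and the other term is small.
  obtain ⟨d, hd⟩ := hens.exists_root hfm (c := 1)
    (fun i => by
      rw [← coeff_map, hsplit]
      exact valuation_coeff_prod_X_sub_C_le_one v _ (fun x hx => hle hx) i)
    (by simp)
    (by
      rw [hevf, hfac, eval_mul, map_mul, hg1, mul_one]
      simpa using h1)
    (by
      rw [hevf, ← derivative_map, hfac, derivative_mul, eval_add, eval_mul, eval_mul]
      simp only [derivative_sub, derivative_X, derivative_C, sub_zero, eval_one, one_mul,
        eval_sub, eval_X, eval_C]
      rw [v.map_add_eq_of_lt_left, hg1]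
      rw [hg1, map_mul]
      exact mul_lt_one_of_lt_of_le h1 hg'1)
  have hdeg := degree_eq_one_of_irreducible_of_root (minpoly.irreducible hγi) hd
  exact minpoly.mem_range_of_degree_eq_one K γ hdeg

/-- Over a henselian field the valuation of the algebraic closure is invariant under
automorphisms. -/
theorem IsHenselianOn.valuation_algEquiv (hens : IsHenselianOn K v) (σ : Ω ≃ₐ[K] Ω) (x : Ω) :
    v (σ x) = v x := by
  classical
  have := IsAlgClosure.isAlgClosed K (K := Ω)
  by_cases hx : x = 0
  · simp [hx]
  have hxi := isIntegral_of_isAlgClosure (K := K) x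
  set S : Finset Ω := ((minpoly K x).map (algebraMap K Ω)).roots.toFinset
  have hS {y : Ω} : y ∈ S ↔ aeval y (minpoly K x) = 0 := by
    rw [Multiset.mem_toFinset, mem_roots', IsRoot, eval_map_algebraMap]
    exact and_iff_right ((minpoly.monic hxi).map _).ne_zero
  have hSσ (τ : Ω ≃ₐ[K] Ω) {y : Ω} (hy : y ∈ S) : τ y ∈ S := by
    rw [hS] at hy ⊢
    rw [show τ y = τ.toAlgHom y from rfl, aeval_algHom_apply, hy, map_zero]
  have hxS : x ∈ S := hS.2 (minpoly.aeval K x)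
  obtain ⟨m, hmS, hmax⟩ := S.exists_max_image v ⟨x, hxS⟩
  have hS0 {y : Ω} (hy : y ∈ S) : y ≠ 0 := by
    obtain ⟨τ, rfl⟩ := exists_algEquiv_of_aeval_minpoly (hS.1 hy)
    simpa using hx
  set T := S.filter fun y => v y = v m
  have hTS : T ⊆ S := S.filter_subset _
  have hmT : m ∈ T := Finset.mem_filter.2 ⟨hmS, rfl⟩
  have hvm : v m ≠ 0 := (v.ne_zero_iff).2 (hS0 hmS)
  set β := ∏ y ∈ T, y
  have hβ : v β = v m ^ T.card := by
    rw [map_prod]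
    exact Finset.prod_eq_pow_card fun y hy => (Finset.mem_filter.1 hy).2
  have hβ0 : v β ≠ 0 := by rw [hβ]; exact pow_ne_zero _ hvm
  have hβne : β ≠ 0 := (v.ne_zero_iff).1 hβ0
  -- `T` collects the conjugates of maximal value, so moving even one factor of β out of `T`
  -- strictly lowers the value of the product. This makes β dominant among its conjugates.
  have hστ (τ : Ω ≃ₐ[K] Ω) : (∀ y ∈ T, τ y ∈ T) ∨ v (τ β) < v β := by
    by_cases h : ∀ y ∈ T, τ y ∈ T
    · exact Or.inl h
    · right
      push Not at h
      obtain ⟨z, hzT, hz⟩ := h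
      rw [hβ, map_prod, map_prod, ← Finset.prod_const]
      refine Finset.prod_lt_prod (fun y hy => ?_) (fun y hy => ?_) ⟨z, hzT, ?_⟩
      · exact zero_lt_iff.2 ((v.ne_zero_iff).2 (hS0 (hSσ τ (hTS hy))))
      · exact hmax _ (hSσ τ (hTS hy))
      · exact lt_of_le_of_ne (hmax _ (hSσ τ (hTS hzT))) fun h =>
          hz (Finset.mem_filter.2 ⟨hSσ τ (hTS hzT), h⟩)
  have hfix {τ : Ω ≃ₐ[K] Ω} (h : ∀ y ∈ T, τ y ∈ T) : τ β = β := by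
    rw [map_prod]
    have himg : T.image τ = T :=
      Finset.eq_of_subset_of_card_le (Finset.image_subset_iff.2 h)
        (Finset.card_image_of_injective T τ.injective).ge
    conv_rhs => rw [show β = ∏ y ∈ T.image τ, y by rw [himg]]
    rw [Finset.prod_image τ.injective.injOn]
  have hβi := isIntegral_of_isAlgClosure (K := K) β
  have hβconj {y : Ω} (hy : aeval y (minpoly K β) = 0) (hyβ : y ≠ β) : v y < v β := by
    obtain ⟨τ, rfl⟩ := exists_algEquiv_of_aeval_minpoly hy
    exact (hστ τ).resolve_left fun h => hyβ (hfix h)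
  -- the sum of the conjugates of `β` is congruent to `β`
  obtain ⟨t, ht⟩ : ∃ t : K, v (algebraMap K Ω t - β) < v β := by
    have hfm : ((minpoly K β).map (algebraMap K Ω)).Monic := (minpoly.monic hβi).map _
    have hmem : β ∈ ((minpoly K β).map (algebraMap K Ω)).roots := by
      rw [mem_roots', IsRoot, eval_map_algebraMap]
      exact ⟨hfm.ne_zero, minpoly.aeval K β⟩
    obtain ⟨s, hs⟩ := Multiset.exists_cons_of_mem hmem
    have hnd : (β ::ₘ s).Nodup :=
      hs ▸ nodup_roots (minpoly.irreducible hβi).separable.map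
    refine ⟨-(minpoly K β).nextCoeff, ?_⟩
    have h1 : algebraMap K Ω (-(minpoly K β).nextCoeff) = β + s.sum := by
      have := Splits.nextCoeff_eq_neg_sum_roots_of_monic
        (IsAlgClosed.splits ((minpoly K β).map (algebraMap K Ω))) hfm
      rw [nextCoeff_map (algebraMap K Ω).injective, hs, Multiset.sum_cons] at this
      rw [map_neg, this, neg_neg]
    rw [h1, add_sub_cancel_left]
    have hlt : ∀ y ∈ s, v y < v β := fun y hy => by
      refine hβconj ?_ fun h => (Multiset.nodup_cons.1 hnd).1 (h ▸ hy)
      have := (mem_roots'.1 (hs ▸ Multiset.mem_cons_of_mem hy :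
        y ∈ ((minpoly K β).map (algebraMap K Ω)).roots)).2
      rwa [IsRoot, eval_map_algebraMap] at this
    clear hs hnd h1
    induction s using Multiset.induction_on with
    | empty => simpa using zero_lt_iff.2 hβ0
    | cons a s ih =>
      rw [Multiset.sum_cons]
      exact v.map_add_lt (hlt a (Multiset.mem_cons_self a s))
        (ih fun y hy => hlt y (Multiset.mem_cons_of_mem hy))
  have hvt : v (algebraMap K Ω t) = v β := by
    have := v.map_add_eq_of_lt_right ht
    rwa [sub_add_cancel] at this
  have ht0 : algebraMap K Ω t ≠ 0 := (v.ne_zero_iff).1 (hvt ▸ hβ0)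
  obtain ⟨b, hb⟩ : β / algebraMap K Ω t ∈ (algebraMap K Ω).range := by
    refine hens.mem_range_of_dominant ?_ fun y hy hne => ?_
    · rw [one_sub_div ht0, map_div₀, hvt]
      exact (div_lt_one₀ (zero_lt_iff.2 hβ0)).2 ht
    · obtain ⟨τ, rfl⟩ := exists_algEquiv_of_aeval_minpoly hy
      rw [map_div₀, τ.commutes, map_div₀, hvt]
      refine (div_lt_one₀ (zero_lt_iff.2 hβ0)).2 ((hστ τ).resolve_left fun h => hne ?_)
      rw [map_div₀, τ.commutes, hfix h]
  have hβK : β = algebraMap K Ω (b * t) := by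
    rw [map_mul, hb, div_mul_cancel₀ _ ht0]
  -- Now that β lies in K, no automorphism lowers its value, so every automorphism stabilises `T`.
  have hall (τ : Ω ≃ₐ[K] Ω) : v (τ m) = v m := by
    refine (Finset.mem_filter.1 ((hστ τ).resolve_right (fun h => ?_) m hmT)).2
    rw [hβK, τ.commutes] at h
    exact h.false
  obtain ⟨ρ, hρ⟩ : ∃ ρ : Ω ≃ₐ[K] Ω, ρ x = m := exists_algEquiv_of_aeval_minpoly (hS.1 hmS)
  have hxm : x = ρ.symm m := by rw [← hρ, AlgEquiv.symm_apply_apply]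
  have h2 : v x = v m := by rw [hxm, hall]
  have h3 : v (σ x) = v m := by
    rw [hxm]
    exact hall (ρ.symm.trans σ)
  rw [h2, h3]

end Conjugates

/-! ### The value of ζ - 1 and the Artin-Schreier substitution -/

section RootsOfUnity

variable {F Γ : Type*} [Field F] [LinearOrderedCommGroupWithZero Γ] {w : Valuation F Γ}

/-- Serves for k + 2 = p: the sum holds exactly the terms of degree 2 to p - 1, whose coefficients
are divisible by p. -/
theorem one_add_pow_eq {R : Type*} [CommRing R] (x : R) (k : ℕ) :
    (1 + x) ^ (k + 2) = 1 + (k + 2 : ℕ) * x +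
      ∑ i ∈ Finset.range k, ((k + 2).choose (i + 2) : R) * x ^ (i + 2) + x ^ (k + 2) := by
  rw [add_comm, add_pow, Finset.sum_range_succ, Finset.sum_range_succ', Finset.sum_range_succ']
  simp only [one_pow, mul_one, Nat.choose_self, Nat.choose_zero_right, Nat.cast_one, pow_zero,
    zero_add, pow_one, Nat.choose_one_right, add_assoc, Nat.reduceAdd]
  rw [Finset.sum_congr rfl fun i _ => mul_comm (x ^ (i + 2)) _]
  ring

theorem valuation_choose_le {p i : ℕ} (hp : p.Prime) (h0 : i ≠ 0) (hi : i < p) :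
    w (p.choose i : F) ≤ w (p : F) := by
  obtain ⟨m, hm⟩ := hp.dvd_choose_self h0 hi
  rw [hm, Nat.cast_mul, map_mul]
  exact mul_le_of_le_one_right' (valuation_natCast_le_one w m)

theorem valuation_eq_one_of_pow_eq_one {n : ℕ} (hn : n ≠ 0) {x : F} (h : x ^ n = 1) :
    w x = 1 := by
  have := congrArg w h
  rw [map_pow, map_one] at this
  exact (pow_eq_one_iff.1 this).resolve_right hn

theorem valuation_pow_sub_one_le {u : F} (hu : w u ≤ 1) (i : ℕ) :
    w (u ^ i - 1) ≤ w (u - 1) := by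
  rw [← geom_sum_mul, map_mul]
  refine mul_le_of_le_one_left' (w.map_sum_le fun j _ => ?_)
  rw [map_pow]
  exact pow_le_one' hu j

/-- Expanding (1 + (ζ - 1))^p = 1 expresses (ζ - 1)^p through terms divisible by p. -/
theorem valuation_root_sub_one_lt_one {p : ℕ} (hp : p.Prime) {ζ : F} (hζ : IsPrimitiveRoot ζ p)
    (hvp : w (p : F) < 1) : w (ζ - 1) < 1 := by
  have hζ1 : w ζ = 1 := valuation_eq_one_of_pow_eq_one hp.ne_zero hζ.pow_eq_one
  have hle : w (ζ - 1) ≤ 1 := w.map_sub_le hζ1.le (map_one w).le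
  obtain ⟨k, rfl⟩ : ∃ k, p = k + 2 := ⟨p - 2, by have := hp.two_le; omega⟩
  have h := one_add_pow_eq (ζ - 1) k
  rw [add_sub_cancel, hζ.pow_eq_one] at h
  have h' : (ζ - 1) ^ (k + 2) = -((k + 2 : ℕ) * (ζ - 1) +
      ∑ i ∈ Finset.range k, ((k + 2).choose (i + 2) : F) * (ζ - 1) ^ (i + 2)) := by
    linear_combination -h
  have h2 : w (ζ - 1) ^ (k + 2) < 1 := by
    rw [← map_pow, h', w.map_neg]
    refine w.map_add_lt ?_ (w.map_sum_lt one_ne_zero fun i hi => ?_)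
    · rw [map_mul]
      exact mul_lt_one_of_lt_of_le hvp hle
    · rw [map_mul, map_pow]
      refine mul_lt_one_of_lt_of_le (lt_of_le_of_lt (valuation_choose_le hp ?_ ?_) hvp)
        (pow_le_one' hle _)
      · omega
      · have := Finset.mem_range.1 hi; omega
  exact lt_of_le_of_ne hle fun h => by rw [h, one_pow] at h2; exact h2.false

/-- Wilson's theorem in the form `p ≡ -(ζ - 1) ^ (p - 1)` modulo elements of larger value. -/
theorem valuation_prime_add_root_sub_one_pow_lt {p : ℕ} (hp : p.Prime) {ζ : F}
    (hζ : IsPrimitiveRoot ζ p) (hvp : w (p : F) < 1) (hp0 : (p : F) ≠ 0) :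
    w ((p : F) + (ζ - 1) ^ (p - 1)) < w (p : F) := by
  have hlt := valuation_root_sub_one_lt_one hp hζ hvp
  have hπ : ζ - 1 ≠ 0 := sub_ne_zero.2 (hζ.ne_one hp.one_lt)
  obtain ⟨k, rfl⟩ : ∃ k, p = k + 2 := ⟨p - 2, by have := hp.two_le; omega⟩
  have h := one_add_pow_eq (ζ - 1) k
  rw [add_sub_cancel, hζ.pow_eq_one] at h
  have hsum : ∑ i ∈ Finset.range k, ((k + 2).choose (i + 2) : F) * (ζ - 1) ^ (i + 2) =
      (ζ - 1) * ∑ i ∈ Finset.range k, ((k + 2).choose (i + 2) : F) * (ζ - 1) ^ (i + 1) := by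
    rw [Finset.mul_sum]
    exact Finset.sum_congr rfl fun i _ => by ring
  have h' : ((k + 2 : ℕ) : F) + (ζ - 1) ^ (k + 2 - 1) =
      -∑ i ∈ Finset.range k, ((k + 2).choose (i + 2) : F) * (ζ - 1) ^ (i + 1) := by
    apply mul_left_cancel₀ hπ
    rw [hsum] at h
    rw [show k + 2 - 1 = k + 1 from rfl]
    linear_combination -h
  rw [h', w.map_neg]
  refine w.map_sum_lt (w.ne_zero_iff.2 hp0) fun i hi => ?_
  rw [map_mul, map_pow]
  have hi' := Finset.mem_range.1 hi
  refine lt_of_le_of_lt (mul_le_mul_left (valuation_choose_le hp (by omega) (by omega)) _) ?_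
  refine mul_lt_of_lt_one_right (zero_lt_iff.2 (w.ne_zero_iff.2 hp0)) ?_
  exact pow_lt_one₀ zero_le hlt (by omega)

theorem valuation_root_sub_one_pow {p : ℕ} (hp : p.Prime) {ζ : F}
    (hζ : IsPrimitiveRoot ζ p) (hvp : w (p : F) < 1) (hp0 : (p : F) ≠ 0) :
    w (ζ - 1) ^ (p - 1) = w (p : F) := by
  have := w.map_sub_eq_of_lt_right (valuation_prime_add_root_sub_one_pow_lt hp hζ hvp hp0)
  rwa [add_sub_cancel_left, map_pow] at this

/-- Up to the factor `(ζ - 1) ^ p`, the polynomial `(1 + (ζ - 1) X) ^ p - 1` is congruent to the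
Artin-Schreier polynomial `X ^ p - X`. -/
theorem exists_polynomial_one_add_root_sub_one_mul_pow {p : ℕ} (hp : p.Prime) {ζ : F}
    (hζ : IsPrimitiveRoot ζ p) (hvp : w (p : F) < 1) (hp0 : (p : F) ≠ 0)
    (A : Type*) [CommRing A] [Algebra F A] :
    ∃ G : F[X], (∀ i, w (G.coeff i) < 1) ∧ G.degree < p ∧ ∀ y : A,
      (1 + algebraMap F A (ζ - 1) * y) ^ p =
        1 + algebraMap F A (ζ - 1) ^ p * (y ^ p - y + aeval y G) := by
  have hπ : ζ - 1 ≠ 0 := sub_ne_zero.2 (hζ.ne_one hp.one_lt)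
  have hlt := valuation_root_sub_one_lt_one hp hζ hvp
  have hw := valuation_prime_add_root_sub_one_pow_lt hp hζ hvp hp0
  have hδ := valuation_root_sub_one_pow hp hζ hvp hp0
  have hδ0 : w (ζ - 1) ≠ 0 := w.ne_zero_iff.2 hπ
  obtain ⟨k, rfl⟩ : ∃ k, p = k + 2 := ⟨p - 2, by have := hp.two_le; omega⟩
  rw [show k + 2 - 1 = k + 1 from rfl] at hw hδ
  set π := ζ - 1
  let b : ℕ → F := fun i => ((k + 2).choose (i + 2) : F) * π ^ (i + 2) / π ^ (k + 2)
  have hb {i : ℕ} (hi : i ∈ Finset.range k) : w (b i) < 1 := by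
    have hi' := Finset.mem_range.1 hi
    rw [map_div₀, map_pow, div_lt_one₀ (zero_lt_iff.2 (pow_ne_zero _ hδ0)), map_mul, map_pow]
    refine lt_of_le_of_lt
      (mul_le_mul_left (valuation_choose_le hp (i := i + 2) (by omega) (by omega)) _) ?_
    rw [← hδ, ← pow_add]
    exact pow_lt_pow_right_of_lt_one₀ (zero_lt_iff.2 hδ0) hlt (by omega)
  -- After division by π^p the linear coefficient is p / π^(p-1), which is -1 plus the small
  -- quotient used here; the `b i` are the middle coefficients after the same division.
  refine ⟨C (((k + 2 : ℕ) + π ^ (k + 1)) / π ^ (k + 1)) * X +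
    ∑ i ∈ Finset.range k, C (b i) * X ^ (i + 2), fun j => ?_, ?_, fun y => ?_⟩
  · rw [coeff_add, finsetSum_coeff]
    refine w.map_add_lt ?_ (w.map_sum_lt one_ne_zero fun i hi => ?_)
    · rw [coeff_C_mul, coeff_X]
      split_ifs
      · rw [mul_one, map_div₀, map_pow, div_lt_one₀ (zero_lt_iff.2 (pow_ne_zero _ hδ0)), hδ]
        exact hw
      · simp
    · rw [coeff_C_mul, coeff_X_pow]
      split_ifs
      · rw [mul_one]; exact hb hi
      · simp
  · refine (degree_add_le _ _).trans_lt (max_lt ?_ ?_)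
    · refine (degree_C_mul_X_le _).trans_lt ?_
      exact_mod_cast (by omega : 1 < k + 2)
    · refine (degree_sum_le _ _).trans_lt ((Finset.sup_lt_iff (WithBot.bot_lt_coe _)).2 ?_)
      intro i hi
      refine (degree_C_mul_X_pow_le _ _).trans_lt ?_
      have := Finset.mem_range.1 hi
      exact_mod_cast (by omega : i + 2 < k + 2)
  · rw [one_add_pow_eq]
    simp only [map_add, map_mul, map_sum, map_pow, aeval_C, aeval_X]
    have h1 : algebraMap F A π ^ (k + 2) *
        algebraMap F A (((k + 2 : ℕ) + π ^ (k + 1)) / π ^ (k + 1)) =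
        (k + 2 : ℕ) * algebraMap F A π + algebraMap F A π ^ (k + 2) := by
      rw [← map_natCast (algebraMap F A), ← map_pow, ← map_mul, ← map_mul, ← map_add]
      congr 1
      field_simp
      ring
    have h2 : algebraMap F A π ^ (k + 2) * ∑ i ∈ Finset.range k, algebraMap F A (b i) * y ^ (i + 2)
        = ∑ i ∈ Finset.range k,
          ((k + 2).choose (i + 2) : A) * (algebraMap F A π * y) ^ (i + 2) := by
      rw [Finset.mul_sum]
      refine Finset.sum_congr rfl fun i _ => ?_
      rw [← mul_assoc, mul_pow, ← mul_assoc, ← map_natCast (algebraMap F A), ← map_pow,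
        ← map_mul, ← map_pow, ← map_mul]
      congr 2
      simp only [b]
      field_simp
    rw [← h2, mul_pow]
    linear_combination (-y) * h1

end RootsOfUnity

/-! ### Kummer generators and their conjugations -/

section Kummer

variable {K Ω : Type*} [Field K] [Field Ω] [Algebra K Ω]

theorem minpoly_eq_X_pow_sub_C {p : ℕ} (hp : p.Prime) {ζ : K} (hζ : IsPrimitiveRoot ζ p)
    {η : Ω} {a : K} (hη : η ^ p = algebraMap K Ω a) (hηK : η ∉ (algebraMap K Ω).range) :
    minpoly K η = X ^ p - C a := by
  have : NeZero p := ⟨hp.ne_zero⟩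
  refine (minpoly.eq_of_irreducible_of_monic
    (X_pow_sub_C_irreducible_of_prime hp fun b hb => hηK ?_)
    (by simp [hη]) (monic_X_pow_sub_C _ hp.ne_zero)).symm
  have hζ' := hζ.map_of_injective (algebraMap K Ω).injective
  by_cases hb0 : b = 0
  · rw [hb0, zero_pow hp.ne_zero] at hb
    rw [← hb, map_zero] at hη
    exact ⟨0, by rw [map_zero, eq_zero_of_pow_eq_zero hη]⟩
  have hb0' : algebraMap K Ω b ≠ 0 := by simpa using hb0
  obtain ⟨i, -, hi⟩ := hζ'.eq_pow_of_pow_eq_one (ξ := η / algebraMap K Ω b) (by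
    rw [div_pow, hη, ← hb, map_pow, div_self (pow_ne_zero _ hb0')])
  exact ⟨ζ ^ i * b, by rw [map_mul, map_pow, hi, div_mul_cancel₀ _ hb0']⟩

/-- If this power of θ lay in K, then θ would have degree at most p^m. It supplies a Kummer
generator inside K(θ) for every n. -/
theorem minpoly_pow_eq_X_pow_sub_C {p : ℕ} (hp : p.Prime) {ζ : K} (hζ : IsPrimitiveRoot ζ p) {m : ℕ} {a : K}
    {θ : Ω} (hmin : minpoly K θ = X ^ p ^ (m + 1) - C a) :
    minpoly K (θ ^ p ^ m) = X ^ p - C a := by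
  refine minpoly_eq_X_pow_sub_C hp hζ ?_ fun ⟨c, hc⟩ => ?_
  · have h := minpoly.aeval K θ
    rw [hmin, map_sub, map_pow, aeval_X, aeval_C, sub_eq_zero] at h
    rw [← h, ← pow_mul, pow_succ]
  · have h0 : p ^ m ≠ 0 := pow_ne_zero _ hp.ne_zero
    have hdvd := natDegree_le_of_dvd (minpoly.dvd K θ (p := X ^ p ^ m - C c) (by simp [hc]))
      (monic_X_pow_sub_C c h0).ne_zero
    rw [hmin, natDegree_X_pow_sub_C, natDegree_X_pow_sub_C] at hdvd
    exact hdvd.not_gt (Nat.pow_lt_pow_right hp.one_lt (Nat.lt_succ_self m))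

theorem exists_algEquiv_apply_eq_root_mul [IsAlgClosure K Ω] {m : ℕ} {θ : Ω} {a z : K}
    (hmin : minpoly K θ = X ^ m - C a) (hz : z ^ m = 1) :
    ∃ σ : Ω ≃ₐ[K] Ω, σ θ = algebraMap K Ω z * θ := by
  refine exists_algEquiv_of_aeval_minpoly ?_
  have h := minpoly.aeval K θ
  rw [hmin] at h ⊢
  rw [map_sub, map_pow, aeval_X, aeval_C] at h ⊢
  rwa [mul_pow, ← map_pow, hz, map_one, one_mul]

theorem algEquiv_apply_eq_of_mem_adjoin (τ : Ω ≃ₐ[K] Ω) {η z : Ω} (hη : τ η = η)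
    (hz : z ∈ K⟮η⟯) : τ z = z := by
  obtain ⟨r, s, rfl⟩ := (mem_adjoin_simple_iff K z).1 hz
  have h (q : K[X]) : τ (aeval η q) = aeval η q := by
    rw [show τ (aeval η q) = τ.toAlgHom (aeval η q) from rfl, ← aeval_algHom_apply]
    exact congrArg (fun x => aeval x q) hη
  rw [map_div₀, h, h]

theorem algEquiv_apply_mem_adjoin (τ : Ω ≃ₐ[K] Ω) {η z : Ω} (hη : τ η ∈ K⟮η⟯)
    (hz : z ∈ K⟮η⟯) : τ z ∈ K⟮η⟯ := by
  obtain ⟨r, s, rfl⟩ := (mem_adjoin_simple_iff K z).1 hz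
  have h (q : K[X]) : τ (aeval η q) ∈ K⟮η⟯ := by
    rw [show τ (aeval η q) = τ.toAlgHom (aeval η q) from rfl, ← aeval_algHom_apply]
    have := aeval_algHom_apply K⟮η⟯.val ⟨τ η, hη⟩ q
    exact this ▸ (aeval (⟨τ η, hη⟩ : K⟮η⟯) q).2
  rw [map_div₀]
  exact div_mem (h r) (h s)

/-- Prime degree leaves no intermediate fields: if z were not in K, it would generate K(η), and τ
would fix η. This is how traces, norms and resolvent quotients are seen to lie in K. -/
theorem mem_range_of_algEquiv_apply_eq (τ : Ω ≃ₐ[K] Ω) {η z : Ω} (hη : τ η ≠ η)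
    (hprime : (Module.finrank K K⟮η⟯).Prime) (hz : z ∈ K⟮η⟯) (hτ : τ z = z) :
    z ∈ (algebraMap K Ω).range := by
  have := isSimpleOrder_of_finrank_prime K K⟮η⟯ hprime
  rcases eq_bot_or_eq_top (K⟮(⟨z, hz⟩ : K⟮η⟯)⟯) with h | h
  · obtain ⟨c, hc⟩ := mem_bot.1 (adjoin_simple_eq_bot_iff.1 h)
    exact ⟨c, congrArg Subtype.val hc⟩
  · obtain ⟨r, s, hrs⟩ := (mem_adjoin_simple_iff K (α := (⟨z, hz⟩ : K⟮η⟯))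
      (⟨η, mem_adjoin_simple_self K η⟩ : K⟮η⟯)).1 (h ▸ mem_top)
    refine absurd (algEquiv_apply_eq_of_mem_adjoin τ hτ ((mem_adjoin_simple_iff K η).2 ⟨r, s, ?_⟩))
      hη
    have h2 (q : K[X]) : ((aeval (⟨z, hz⟩ : K⟮η⟯) q : K⟮η⟯) : Ω) = aeval z q :=
      (aeval_algHom_apply K⟮η⟯.val (⟨z, hz⟩ : K⟮η⟯) q).symm
    have := congrArg Subtype.val hrs
    rw [← h2, ← h2]
    exact this

end Kummer

/-! ### An elementwise criterion for purely wild extensions -/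

section Criterion

variable {K Ω Γ : Type*} [Field K] [Field Ω] [Algebra K Ω]
  [LinearOrderedCommGroupWithZero Γ] {v : Valuation Ω Γ}

theorem mem_residueField_bot {r : IsLocalRing.ResidueField v.valuationSubring} :
    r ∈ residueField v (⊥ : IntermediateField K Ω) ↔ ∃ (c : K) (hc : v (algebraMap K Ω c) ≤ 1),
      IsLocalRing.residue v.valuationSubring ⟨algebraMap K Ω c, hc⟩ = r := by
  constructor
  · rintro ⟨⟨x, hx'⟩, hx, rfl⟩
    obtain ⟨c, rfl⟩ := mem_bot.1 hx
    exact ⟨c, hx', rfl⟩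
  · rintro ⟨c, hc, rfl⟩
    exact ⟨⟨_, hc⟩, IntermediateField.algebraMap_mem _ c, rfl⟩

theorem mem_valueGroup_bot {γ : Γˣ} :
    γ ∈ valueGroup v (⊥ : IntermediateField K Ω) ↔ ∃ c : K, v (algebraMap K Ω c) = γ := by
  constructor
  · rintro ⟨x, hx, hγ⟩
    obtain ⟨c, rfl⟩ := mem_bot.1 hx
    exact ⟨c, hγ⟩
  · rintro ⟨c, hc⟩
    exact ⟨_, IntermediateField.algebraMap_mem _ c, hc⟩

/-- A condition on single elements of L passes at once to subextensions and to unions of chains,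
unlike one phrased with quotient groups and residue extensions. -/
theorem isPurelyWild_iff {p : ℕ} (hp : p.Prime)
    [CharP (residueField v (⊥ : IntermediateField K Ω)) p] (L : IntermediateField K Ω) :
    IsPurelyWild p v L ↔
      (∀ x ∈ L, x ≠ 0 → ∃ (k : ℕ) (c : K), v x ^ p ^ k = v (algebraMap K Ω c)) ∧
      ∀ x : v.valuationSubring, (x : Ω) ∈ L → ∃ k : ℕ,
        IsLocalRing.residue _ x ^ p ^ k ∈ residueField v (⊥ : IntermediateField K Ω) := by
  have : ExpChar (residueField v (⊥ : IntermediateField K Ω)) p := .prime hp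
  rw [IsPurelyWild, isPurelyInseparable_iff_pow_mem _ p]
  refine and_congr ⟨fun h x hx hx0 => ?_, fun h g => ?_⟩ ⟨fun h x hx => ?_, fun h r => ?_⟩
  · obtain ⟨k, hk⟩ := h (QuotientGroup.mk ⟨Units.mk0 (v x) (v.ne_zero_iff.2 hx0), x, hx, rfl⟩)
    rw [← QuotientGroup.mk_pow, QuotientGroup.eq_one_iff, Subgroup.mem_subgroupOf,
      mem_valueGroup_bot] at hk
    obtain ⟨c, hc⟩ := hk
    exact ⟨k, c, by simpa using hc.symm⟩
  · induction g using QuotientGroup.induction_on with | H g => ?_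
    obtain ⟨γ, x, hx, hγ⟩ := g
    obtain ⟨k, c, hc⟩ := h x hx fun h0 => by
      rw [h0, map_zero] at hγ
      exact γ.ne_zero hγ.symm
    refine ⟨k, ?_⟩
    rw [← QuotientGroup.mk_pow, QuotientGroup.eq_one_iff, Subgroup.mem_subgroupOf,
      mem_valueGroup_bot]
    exact ⟨c, by simp [← hc, hγ]⟩
  · obtain ⟨k, s, hs⟩ := h ⟨IsLocalRing.residue _ x, x, hx, rfl⟩
    refine ⟨k, ?_⟩
    have := congrArg Subtype.val hs
    rw [SubmonoidClass.coe_pow] at this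
    exact this ▸ s.2
  · obtain ⟨r, x, hx, rfl⟩ := r
    obtain ⟨k, hk⟩ := h x hx
    exact ⟨k, ⟨_, hk⟩, rfl⟩

theorem IsPurelyWild.mono {p : ℕ} (hp : p.Prime)
    [CharP (residueField v (⊥ : IntermediateField K Ω)) p] {L M : IntermediateField K Ω}
    (hM : IsPurelyWild p v M) (h : L ≤ M) : IsPurelyWild p v L := by
  rw [isPurelyWild_iff hp] at hM ⊢
  exact ⟨fun x hx => hM.1 x (h hx), fun x hx => hM.2 x (h hx)⟩

/-- Every purely wild extension is contained in a maximal one. -/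
theorem IsPurelyWild.exists_isMaximalPurelyWild {p : ℕ} (hp : p.Prime)
    [CharP (residueField v (⊥ : IntermediateField K Ω)) p] {L : IntermediateField K Ω}
    (hL : IsPurelyWild p v L) : ∃ M, L ≤ M ∧ IsMaximalPurelyWild p v M := by
  refine zorn_le_nonempty₀ {M : IntermediateField K Ω | IsPurelyWild p v M}
    (fun c hc hchain y hy => ⟨sSup c, ?_, fun z hz => le_sSup hz⟩) L hL
  have hmem {x : Ω} (hx : x ∈ sSup c) : ∃ M ∈ c, x ∈ M := by
    have : Nonempty c := ⟨⟨y, hy⟩⟩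
    have hdir : Directed (· ≤ ·) fun M : c => (M : IntermediateField K Ω) :=
      directedOn_iff_directed.1 hchain.directedOn
    rw [sSup_eq_iSup', ← SetLike.mem_coe, coe_iSup_of_directed hdir, Set.mem_iUnion] at hx
    obtain ⟨M, hM⟩ := hx
    exact ⟨M, M.2, hM⟩
  refine (isPurelyWild_iff hp _).2 ⟨fun x hx => ?_, fun x hx => ?_⟩ <;>
    obtain ⟨M, hMc, hxM⟩ := hmem hx
  · exact ((isPurelyWild_iff hp M).1 (hc hMc)).1 x hxM
  · exact ((isPurelyWild_iff hp M).1 (hc hMc)).2 x hxM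

end Criterion

/-! ### Powers of a conjugation of order p on K(η) -/

section Iterates

variable {K Ω : Type*} [Field K] [Field Ω] [Algebra K Ω]

theorem pow_apply_eq_root_pow_mul {σ : Ω ≃ₐ[K] Ω} {z : K} {η : Ω}
    (hσ : σ η = algebraMap K Ω z * η) (i : ℕ) : (σ ^ i) η = algebraMap K Ω z ^ i * η := by
  induction i with
  | zero => simp
  | succ i ih =>
    rw [pow_succ', AlgEquiv.mul_apply, ih, map_mul, map_pow, σ.commutes, hσ]
    ring

/-- The cyclic reindexing by which σ acts on traces and Lagrange resolvents. -/
theorem sum_range_succ_shift {M : Type*} [AddCommMonoid M] [IsRightCancelAdd M]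
    {n : ℕ} {f : ℕ → M} (h : f n = f 0) :
    ∑ i ∈ Finset.range n, f (i + 1) = ∑ i ∈ Finset.range n, f i := by
  have := (Finset.sum_range_succ' f n).symm.trans (Finset.sum_range_succ f n)
  rw [h] at this
  exact add_right_cancel this

variable {p : ℕ} {ζ : K} {η : Ω} {σ : Ω ≃ₐ[K] Ω}

theorem pow_prime_apply_eq (hζ : IsPrimitiveRoot ζ p) (hσ : σ η = algebraMap K Ω ζ * η) {x : Ω}
    (hx : x ∈ K⟮η⟯) : (σ ^ p) x = x :=
  algEquiv_apply_eq_of_mem_adjoin _ (by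
    rw [pow_apply_eq_root_pow_mul hσ, ← map_pow, hζ.pow_eq_one, map_one, one_mul]) hx

theorem pow_apply_mem_adjoin (hσ : σ η = algebraMap K Ω ζ * η) {x : Ω} (hx : x ∈ K⟮η⟯) (i : ℕ) :
    (σ ^ i) x ∈ K⟮η⟯ :=
  algEquiv_apply_mem_adjoin _ (by
    rw [pow_apply_eq_root_pow_mul hσ, ← map_pow]
    exact mul_mem (IntermediateField.algebraMap_mem _ _) (mem_adjoin_simple_self K η)) hx

end Iterates

/-! ### Distance to K against the action on residues -/

section Dichotomy

variable {K Ω Γ : Type*} [Field K] [CharZero K] [Field Ω] [Algebra K Ω] [IsAlgClosure K Ω]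
  [LinearOrderedCommGroupWithZero Γ] {v : Valuation Ω Γ}

/-- An element conjugate to its product with `ζ` has distance at least `v (ζ - 1)` from `K`. -/
theorem IsHenselianOn.root_sub_one_le (hens : IsHenselianOn K v) {z : K} {θ : Ω}
    (hθ : v θ = 1) {σ : Ω ≃ₐ[K] Ω} (hσ : σ θ = algebraMap K Ω z * θ) (c : K) :
    v (algebraMap K Ω z - 1) ≤ v (θ - algebraMap K Ω c) := by
  have h1 : v (algebraMap K Ω z * θ - algebraMap K Ω c) = v (θ - algebraMap K Ω c) := by
    rw [← hens.valuation_algEquiv σ (θ - algebraMap K Ω c), _root_.map_sub σ, hσ, σ.commutes]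
  have h2 : v (algebraMap K Ω z - 1) = v (algebraMap K Ω z * θ - θ) := by
    rw [← sub_one_mul, map_mul, hθ, mul_one]
  rw [h2, ← sub_sub_sub_cancel_right _ _ (algebraMap K Ω c)]
  exact v.map_sub_le h1.le le_rfl

variable {p : ℕ} {ζ : K} {η : Ω} {σ : Ω ≃ₐ[K] Ω}

/-- If some conjugation acts nontrivially on the residues of a Kummer extension, then the extension
contains an integral element whose trace is a unit. -/
theorem IsHenselianOn.exists_valuation_trace_eq_one (hens : IsHenselianOn K v) (hp : p.Prime)
    (hζ : IsPrimitiveRoot ζ p) (hσ : σ η = algebraMap K Ω ζ * η)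
    {x₀ : Ω} (hx₀ : x₀ ∈ K⟮η⟯) (hx₀1 : v x₀ ≤ 1) (hne : ¬ v (x₀ - σ x₀) < 1) :
    ∃ x ∈ K⟮η⟯, v x ≤ 1 ∧ v (∑ i ∈ Finset.range p, (σ ^ i) x) = 1 := by
  let M : Submonoid Ω :=
    { carrier := {x | x ∈ K⟮η⟯ ∧ v x ≤ 1}
      one_mem' := ⟨one_mem _, (map_one v).le⟩
      mul_mem' := fun {a b} ha hb => ⟨mul_mem ha.1 hb.1, by
        rw [map_mul]; exact mul_le_one' ha.2 hb.2⟩ }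
  have hint (i : ℕ) (x : M) : (σ ^ i) x ∈ v.valuationSubring := by
    rw [Valuation.mem_valuationSubring_iff, hens.valuation_algEquiv]
    exact x.2.2
  -- The σ^i followed by reduction are characters of the monoid of integral elements. Once they are
  -- distinct for i < p, Dedekind independence makes their sum nonzero.
  let f : ℕ → M →* IsLocalRing.ResidueField v.valuationSubring := fun i =>
    { toFun := fun x => IsLocalRing.residue v.valuationSubring ⟨(σ ^ i) x, hint i x⟩
      map_one' := by
        rw [← map_one (IsLocalRing.residue v.valuationSubring)]
        congr 1
        exact Subtype.ext (map_one (σ ^ i))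
      map_mul' := fun x y => by
        rw [← map_mul (IsLocalRing.residue v.valuationSubring)]
        congr 1
        exact Subtype.ext (map_mul (σ ^ i) (x : Ω) y) }
  have hlt {i j : ℕ} (hij : i < j) (hj : j < p) : f i ≠ f j := by
    intro h
    have h1 (x : M) : v ((x : Ω) - (σ ^ (j - i)) x) < 1 := by
      have := (residue_eq_iff_valuation_sub_lt_one v _ _).1 (DFunLike.congr_fun h x)
      rw [← hens.valuation_algEquiv (σ ^ i), map_sub, ← AlgEquiv.mul_apply, ← pow_add,
        Nat.add_sub_cancel' hij.le]
      exact this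
    have h2 (l : ℕ) (x : M) : v ((x : Ω) - (σ ^ ((j - i) * l)) x) < 1 := by
      induction l with
      | zero => simp
      | succ l ih =>
        rw [← sub_add_sub_cancel _ ((σ ^ ((j - i) * l)) (x : Ω)) _]
        refine v.map_add_lt ih ?_
        rw [Nat.mul_succ, pow_add, AlgEquiv.mul_apply, ← map_sub, hens.valuation_algEquiv]
        exact h1 x
    -- As j - i is invertible modulo p, some power of σ^(j-i) agrees with σ on K(η), so σ too would
    -- act trivially on residues.
    have hcop : (j - i).Coprime p :=
      (Nat.coprime_of_lt_prime (by omega) (by omega) hp).symm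
    obtain ⟨l, -, hl⟩ := Nat.exists_mul_mod_eq_one_of_coprime hcop hp.one_lt
    apply hne
    have h3 := h2 l ⟨x₀, hx₀, hx₀1⟩
    have hq (q : ℕ) : (σ ^ (p * q)) x₀ = x₀ := by
      induction q with
      | zero => simp
      | succ q ih =>
        rw [Nat.mul_succ, pow_add, AlgEquiv.mul_apply, pow_prime_apply_eq hζ hσ hx₀, ih]
    rw [← Nat.div_add_mod ((j - i) * l) p, hl, add_comm, pow_add, AlgEquiv.mul_apply, hq,
      pow_one] at h3
    exact h3
  have hinj : Function.Injective fun i : Fin p => f i := by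
    intro i j hij
    by_contra hne
    rcases lt_or_gt_of_ne (Fin.val_ne_of_ne hne) with h | h
    · exact hlt h j.2 hij
    · exact hlt h i.2 hij.symm
  have hli := (linearIndependent_monoidHom M
    (IsLocalRing.ResidueField v.valuationSubring)).comp _ hinj
  obtain ⟨x, hx⟩ : ∃ x : M, ∑ i ∈ Finset.range p, f i x ≠ 0 := by
    by_contra! h
    refine one_ne_zero (Fintype.linearIndependent_iff.1 hli (fun _ => 1) ?_ ⟨0, hp.pos⟩)
    ext x
    simpa [Finset.sum_range] using h x
  refine ⟨x, x.2.1, x.2.2, ?_⟩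
  have hsum : v (∑ i ∈ Finset.range p, (σ ^ i) (x : Ω)) ≤ 1 :=
    v.map_sum_le fun i _ => hint i x
  refine le_antisymm hsum (not_lt.1 fun h => hx ?_)
  have := (residue_eq_zero_iff_valuation_lt_one v
    (∑ i ∈ Finset.range p, (⟨(σ ^ i) x, hint i x⟩ : v.valuationSubring))).2 (by
      rw [AddSubmonoidClass.coe_finsetSum]; exact h)
  rw [map_sum] at this
  exact this

/-- A Kummer generator of value one has distance at most `v (ζ - 1)` from `K` as soon as some
conjugation acts nontrivially on the residues. -/
theorem IsHenselianOn.exists_valuation_sub_le (hens : IsHenselianOn K v) (hp : p.Prime)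
    (hζ : IsPrimitiveRoot ζ p) (hvp : v (p : Ω) < 1) (hη : v η = 1)
    (hfin : Module.finrank K K⟮η⟯ = p) (hσ : σ η = algebraMap K Ω ζ * η)
    {x₀ : Ω} (hx₀ : x₀ ∈ K⟮η⟯) (hx₀1 : v x₀ ≤ 1) (hne : ¬ v (x₀ - σ x₀) < 1) :
    ∃ c : K, v (η - algebraMap K Ω c) ≤ v (algebraMap K Ω ζ - 1) := by
  obtain ⟨x, hx, hx1, htr⟩ := hens.exists_valuation_trace_eq_one hp hζ hσ hx₀ hx₀1 hne
  have hζ' := hζ.map_of_injective (algebraMap K Ω).injective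
  set z := algebraMap K Ω ζ with hz
  have hη0 : η ≠ 0 := v.ne_zero_iff.1 (by rw [hη]; exact one_ne_zero)
  have hσne : σ η ≠ η := by
    rw [hσ]
    intro h
    exact hζ'.ne_one hp.one_lt (mul_right_cancel₀ hη0 (h.trans (one_mul η).symm))
  have hz0 : z ≠ 0 := hζ'.ne_zero hp.ne_zero
  have hz1 : v z = 1 := valuation_eq_one_of_pow_eq_one hp.ne_zero hζ'.pow_eq_one
  have hmem (i : ℕ) : (σ ^ i) x ∈ K⟮η⟯ := pow_apply_mem_adjoin hσ hx i
  obtain ⟨t, ht⟩ : ∑ i ∈ Finset.range p, (σ ^ i) x ∈ (algebraMap K Ω).range := by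
    refine mem_range_of_algEquiv_apply_eq σ hσne (hfin.symm ▸ hp) (sum_mem fun i _ => hmem i) ?_
    rw [map_sum]
    simp_rw [← AlgEquiv.mul_apply, ← pow_succ']
    exact sum_range_succ_shift (f := fun i => (σ ^ i) x)
      (by rw [pow_prime_apply_eq hζ hσ hx]; simp)
  -- Lagrange resolvent: σ multiplies it by ζ just as it does η, so it is a K-multiple of η; since ζ
  -- ≡ 1 modulo ζ - 1, it is congruent to the trace `t`, a unit.
  set e := ∑ i ∈ Finset.range p, z⁻¹ ^ i * (σ ^ i) x with he
  have hσe : σ e = z * e := by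
    have hshift := sum_range_succ_shift (n := p) (f := fun i => z⁻¹ ^ i * (σ ^ i) x)
      (by rw [pow_prime_apply_eq hζ hσ hx, inv_pow, hζ'.pow_eq_one]; simp)
    rw [he, map_sum, ← hshift, Finset.mul_sum]
    refine Finset.sum_congr rfl fun i _ => ?_
    rw [map_mul, map_pow, map_inv₀, hz, σ.commutes, ← hz, ← AlgEquiv.mul_apply, ← pow_succ',
      pow_succ z⁻¹ i]
    field_simp
  obtain ⟨k, hk⟩ : e / η ∈ (algebraMap K Ω).range := by
    refine mem_range_of_algEquiv_apply_eq σ hσne (hfin.symm ▸ hp)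
      (div_mem (sum_mem fun i _ => mul_mem (pow_mem (inv_mem (IntermediateField.algebraMap_mem _ _)) _) (hmem i))
        (mem_adjoin_simple_self K η)) ?_
    rw [map_div₀, hσe, hσ, mul_div_mul_left _ _ hz0]
  have hke : algebraMap K Ω k * η = e := by rw [hk, div_mul_cancel₀ _ hη0]
  rw [← ht] at htr
  have hinv : v (z⁻¹ - 1) = v (z - 1) := by
    rw [← one_div, div_sub_one hz0, map_div₀, hz1, div_one, v.map_sub_swap]
  have hd : v (algebraMap K Ω k * η - algebraMap K Ω t) ≤ v (z - 1) := by
    rw [hke, ht, he, ← Finset.sum_sub_distrib]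
    refine v.map_sum_le fun i _ => ?_
    rw [← sub_one_mul, map_mul, ← hinv]
    refine (mul_le_mul' (valuation_pow_sub_one_le ?_ i) ?_).trans (mul_one _).le
    · rw [map_inv₀, hz1, inv_one]
    · rw [hens.valuation_algEquiv]; exact hx1
  have hlt : v (algebraMap K Ω k * η - algebraMap K Ω t) < v (algebraMap K Ω t) := by
    rw [htr]
    exact hd.trans_lt (valuation_root_sub_one_lt_one hp hζ' hvp)
  have hvk : v (algebraMap K Ω k) = 1 := by
    have := v.map_add_eq_of_lt_right hlt
    rwa [sub_add_cancel, map_mul, hη, mul_one, htr] at this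
  have hk0 : algebraMap K Ω k ≠ 0 := v.ne_zero_iff.1 (by rw [hvk]; exact one_ne_zero)
  refine ⟨t / k, ?_⟩
  have h2 : η - algebraMap K Ω (t / k) =
      (algebraMap K Ω k * η - algebraMap K Ω t) / algebraMap K Ω k := by
    rw [map_div₀]
    field_simp
  rwa [h2, map_div₀, hvk, div_one]

/-- A Kummer extension whose generator of value one stays away from `K` is purely wild. -/
theorem IsHenselianOn.isPurelyWild_of_forall_lt (hens : IsHenselianOn K v) (hp : p.Prime)
    [CharP (residueField v (⊥ : IntermediateField K Ω)) p]
    (hζ : IsPrimitiveRoot ζ p) (hvp : v (p : Ω) < 1) (hη : v η = 1)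
    (hfin : Module.finrank K K⟮η⟯ = p) (hσ : σ η = algebraMap K Ω ζ * η)
    (hfar : ∀ c : K, v (algebraMap K Ω ζ - 1) < v (η - algebraMap K Ω c)) :
    IsPurelyWild p v K⟮η⟯ := by
  have hζ' := hζ.map_of_injective (algebraMap K Ω).injective
  have hη0 : η ≠ 0 := v.ne_zero_iff.1 (by rw [hη]; exact one_ne_zero)
  have hσne : σ η ≠ η := by
    rw [hσ]
    intro h
    exact hζ'.ne_one hp.one_lt (mul_right_cancel₀ hη0 (h.trans (one_mul η).symm))
  have hnorm {x : Ω} (hx : x ∈ K⟮η⟯) :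
      ∏ i ∈ Finset.range p, (σ ^ i) x ∈ (algebraMap K Ω).range := by
    refine mem_range_of_algEquiv_apply_eq σ hσne (hfin.symm ▸ hp)
      (prod_mem fun i _ => pow_apply_mem_adjoin hσ hx i) ?_
    by_cases hx0 : x = 0
    · simp [hx0, Finset.prod_const, hp.ne_zero]
    rw [map_prod]
    simp_rw [← AlgEquiv.mul_apply, ← pow_succ']
    have := (Finset.prod_range_succ' (fun i => (σ ^ i) x) p).symm.trans
      (Finset.prod_range_succ (fun i => (σ ^ i) x) p)
    rw [pow_prime_apply_eq hζ hσ hx, pow_zero, AlgEquiv.one_apply] at this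
    exact mul_right_cancel₀ hx0 this
  have htriv {x : Ω} (hx : x ∈ K⟮η⟯) (hx1 : v x ≤ 1) : v (x - σ x) < 1 := by
    by_contra h
    obtain ⟨c, hc⟩ := hens.exists_valuation_sub_le hp hζ hvp hη hfin hσ hx hx1 h
    exact (hfar c).not_ge hc
  -- All p conjugates of x have the same value and, for integral x, the same residue, so the norm of
  -- x shows that the p-th powers of both come from K.
  refine (isPurelyWild_iff hp _).2 ⟨fun x hx _ => ?_, fun x hx => ⟨1, ?_⟩⟩
  · obtain ⟨c, hc⟩ := hnorm hx
    refine ⟨1, c, ?_⟩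
    rw [hc, map_prod, Finset.prod_congr rfl fun i _ => hens.valuation_algEquiv (σ ^ i) x]
    simp
  · obtain ⟨c, hc⟩ := hnorm hx
    have hint (i : ℕ) : (σ ^ i) (x : Ω) ∈ v.valuationSubring := by
      rw [Valuation.mem_valuationSubring_iff, hens.valuation_algEquiv]
      exact x.2
    have hres (i : ℕ) : IsLocalRing.residue v.valuationSubring ⟨(σ ^ i) (x : Ω), hint i⟩ =
        IsLocalRing.residue v.valuationSubring x := by
      induction i with
      | zero => rfl
      | succ i ih =>
        have := htriv (pow_apply_mem_adjoin hσ hx i) (hint i)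
        rw [← AlgEquiv.mul_apply, ← pow_succ'] at this
        rw [← ih, residue_eq_iff_valuation_sub_lt_one, v.map_sub_swap]
        exact this
    refine ⟨∏ i ∈ Finset.range p, ⟨(σ ^ i) (x : Ω), hint i⟩, ?_, ?_⟩
    · rw [SubmonoidClass.coe_finsetProd, ← hc]
      exact IntermediateField.algebraMap_mem _ c
    · rw [map_prod, Finset.prod_congr rfl fun i _ => hres i]
      simp

end Dichotomy

/-! ### Residue characteristic, separability and power bases -/

section Unramified

variable {K Ω Γ : Type*} [Field K] [Field Ω] [Algebra K Ω]
  [LinearOrderedCommGroupWithZero Γ] {v : Valuation Ω Γ}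

theorem charP_residueField_valuationSubring {p : ℕ}
    [CharP (residueField v (⊥ : IntermediateField K Ω)) p] :
    CharP (IsLocalRing.ResidueField v.valuationSubring) p :=
  charP_of_injective_ringHom
    (residueField v (⊥ : IntermediateField K Ω)).subtype.injective p

theorem valuation_natCast_lt_one {p : ℕ}
    [CharP (IsLocalRing.ResidueField v.valuationSubring) p] : v (p : Ω) < 1 := by
  have := (residue_eq_zero_iff_valuation_lt_one v (p : v.valuationSubring)).1 (by
    rw [map_natCast, CharP.cast_eq_zero])
  simpa using this

theorem separable_X_pow_sub_X_sub_C {k : Type*} [Field k] (p : ℕ) [CharP k p] (r : k) :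
    (X ^ p - X - C r : k[X]).Separable := by
  rw [separable_def]
  have : derivative (X ^ p - X - C r : k[X]) = -1 := by
    simp [derivative_X_pow]
  rw [this]
  exact isCoprime_one_right.neg_right

theorem exists_eq_sum_of_mem_adjoin {y x : Ω} {n : ℕ} (hn : n ≠ 0)
    (hfin : Module.finrank K K⟮y⟯ = n) (hx : x ∈ K⟮y⟯) :
    ∃ c : Fin n → K, x = ∑ j, algebraMap K Ω (c j) * y ^ (j : ℕ) := by
  have : FiniteDimensional K K⟮y⟯ := .of_finrank_pos (by omega)
  have hy : IsIntegral K y :=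
    (AdjoinSimple.isIntegral_gen K y).1 (Algebra.IsIntegral.isIntegral (AdjoinSimple.gen K y))
  rw [← mem_toSubalgebra, adjoin_simple_toSubalgebra_of_isAlgebraic hy.isAlgebraic,
    Algebra.adjoin_singleton_eq_range_aeval] at hx
  obtain ⟨q, rfl⟩ := hx
  refine ⟨fun j => (q %ₘ minpoly K y).coeff j, ?_⟩
  have hlt : (q %ₘ minpoly K y).natDegree < n := by
    rw [← hfin, adjoin.finrank hy]
    exact natDegree_modByMonic_lt q (minpoly.monic hy) (minpoly.ne_one K y)
  have h : aeval y q = aeval y (q %ₘ minpoly K y) := by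
    rw [aeval_modByMonic_eq_self_of_root (minpoly.aeval K y)]
  rw [show (aeval y).toRingHom q = aeval y q from rfl, h, aeval_eq_sum_range' hlt,
    Finset.sum_range]
  simp_rw [Algebra.smul_def]

end Unramified

/-! ### Generators whose residue has p conjugates -/

section Residues

variable {K Ω Γ : Type*} [Field K] [CharZero K] [Field Ω] [Algebra K Ω] [IsAlgClosure K Ω]
  [LinearOrderedCommGroupWithZero Γ] {v : Valuation Ω Γ} {p : ℕ} {y : Ω} {σ : Ω ≃ₐ[K] Ω}

/-- If the residue of `y` has `p` conjugates, then its first `p` powers are linearly independent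
over the residue field of `K`. -/
theorem IsHenselianOn.valuation_coeff_lt_one (hens : IsHenselianOn K v)
    [CharP (IsLocalRing.ResidueField v.valuationSubring) p] (hy : v y ≤ 1)
    (hσ : ∀ i : ℕ, v ((σ ^ i) y - (y + i)) < 1) {c : Fin p → K}
    (hc : ∀ j, v (algebraMap K Ω (c j)) ≤ 1)
    (hlt : v (∑ j, algebraMap K Ω (c j) * y ^ (j : ℕ)) < 1) (j : Fin p) :
    v (algebraMap K Ω (c j)) < 1 := by
  let c' : Fin p → v.valuationSubring := fun j => ⟨_, hc j⟩
  let y' : v.valuationSubring := ⟨y, hy⟩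
  set res := IsLocalRing.residue v.valuationSubring
  set Q : Polynomial (IsLocalRing.ResidueField v.valuationSubring) :=
    ∑ j : Fin p, C (res (c' j)) * X ^ (j : ℕ) with hQ
  have hint (i : ℕ) : v ((σ ^ i) y) ≤ 1 := by rwa [hens.valuation_algEquiv]
  have hres (i : ℕ) : res y' + (i : IsLocalRing.ResidueField v.valuationSubring) = res ⟨(σ ^ i) y, hint i⟩ := by
    rw [← map_natCast res, ← map_add, eq_comm, residue_eq_iff_valuation_sub_lt_one]
    exact hσ i
  have hQ0 : Q = 0 := by
    -- `Q` has degree less than p but vanishes at the p distinct residues of the conjugates y + i.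
    refine eq_zero_of_degree_lt_of_eval_index_eq_zero (s := Finset.univ)
      (v := fun i : Fin p => res y' + ((i : ℕ) : IsLocalRing.ResidueField v.valuationSubring))
      (fun i _ j _ hij => ?_) ?_ fun i _ => ?_
    · exact Fin.ext (CharP.natCast_injOn_Iio _ p i.2 j.2 (add_left_cancel hij))
    · rw [Finset.card_univ, Fintype.card_fin]
      exact degree_sum_fin_lt _
    · have h : Q.eval (res y' + ((i : ℕ) : IsLocalRing.ResidueField v.valuationSubring)) =
          res (∑ j, c' j * ⟨(σ ^ (i : ℕ)) y, hint i⟩ ^ (j : ℕ)) := by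
        rw [hres, hQ, eval_finsetSum, map_sum]
        refine Finset.sum_congr rfl fun j _ => ?_
        rw [eval_mul, eval_C, eval_pow, eval_X, map_mul, map_pow]
      rw [h, residue_eq_zero_iff_valuation_lt_one]
      have h2 : (σ ^ (i : ℕ)) (∑ j, algebraMap K Ω (c j) * y ^ (j : ℕ)) =
          ((∑ j, c' j * ⟨(σ ^ (i : ℕ)) y, hint i⟩ ^ (j : ℕ) : v.valuationSubring) : Ω) := by
        rw [AddSubmonoidClass.coe_finsetSum, map_sum]
        refine Finset.sum_congr rfl fun j _ => ?_
        rw [map_mul, map_pow, AlgEquiv.commutes]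
        rfl
      rw [← h2, hens.valuation_algEquiv]
      exact hlt
  have hcoeff : Q.coeff j = res (c' j) := by
    rw [hQ, finsetSum_coeff]
    simp [coeff_C_mul, coeff_X_pow, Fin.val_inj]
  rw [hQ0, coeff_zero] at hcoeff
  exact (residue_eq_zero_iff_valuation_lt_one v _).1 hcoeff.symm

/-- Dividing by a coefficient of largest value reduces to the residual independence of the powers of
y. Values on K(y) are thus values of coefficients, and integral elements have integral coefficients.
-/
theorem IsHenselianOn.exists_valuation_sum_eq (hens : IsHenselianOn K v) (hp : p ≠ 0)
    [CharP (IsLocalRing.ResidueField v.valuationSubring) p] (hy : v y ≤ 1)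
    (hσ : ∀ i : ℕ, v ((σ ^ i) y - (y + i)) < 1) (c : Fin p → K) :
    ∃ j, (∀ i, v (algebraMap K Ω (c i)) ≤ v (algebraMap K Ω (c j))) ∧
      v (∑ j, algebraMap K Ω (c j) * y ^ (j : ℕ)) = v (algebraMap K Ω (c j)) := by
  have : NeZero p := ⟨hp⟩
  obtain ⟨j, -, hj⟩ := Finset.univ.exists_max_image (fun j => v (algebraMap K Ω (c j)))
    Finset.univ_nonempty
  have hj' (i : Fin p) := hj i (Finset.mem_univ i)
  refine ⟨j, hj', le_antisymm (v.map_sum_le fun i _ => ?_) (not_lt.1 fun h => ?_)⟩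
  · rw [map_mul, map_pow]
    exact (mul_le_mul' (hj' i) (pow_le_one' hy _)).trans (mul_one _).le
  · have h0 : 0 < v (algebraMap K Ω (c j)) := zero_le.trans_lt h
    have hne : algebraMap K Ω (c j) ≠ 0 := v.ne_zero_iff.1 h0.ne'
    refine (hens.valuation_coeff_lt_one hy hσ (c := fun i => c i / c j) (fun i => ?_) ?_ j).ne ?_
    · rw [map_div₀, map_div₀]
      exact (div_le_one₀ h0).2 (hj' i)
    · simp_rw [map_div₀, div_mul_eq_mul_div]
      rw [← Finset.sum_div, map_div₀]
      exact (div_lt_one₀ h0).2 h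
    · rw [map_div₀, div_self hne, map_one]

/-- An extension of prime degree generated by an element whose residue has `p` conjugates is
unramified and defectless. -/
theorem IsHenselianOn.isDefectless_and_isUnramified (hens : IsHenselianOn K v) (hp : p.Prime)
    [CharP (residueField v (⊥ : IntermediateField K Ω)) p] (hy : v y ≤ 1)
    (hσ : ∀ i : ℕ, v ((σ ^ i) y - (y + i)) < 1) (hfin : Module.finrank K K⟮y⟯ = p)
    {b : K} (hb : v (algebraMap K Ω b) ≤ 1) (hyb : v (y ^ p - y - algebraMap K Ω b) < 1) :
    IsDefectless v K⟮y⟯ ∧ IsUnramified p v K⟮y⟯ := by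
  have hchar : CharP (IsLocalRing.ResidueField v.valuationSubring) p :=
    charP_residueField_valuationSubring (K := K)
  set res := IsLocalRing.residue v.valuationSubring
  set k := residueField v (⊥ : IntermediateField K Ω)
  let y' : v.valuationSubring := ⟨y, hy⟩
  have hval : valueGroup v K⟮y⟯ = valueGroup v (⊥ : IntermediateField K Ω) := by
    refine le_antisymm ?_ fun γ ⟨x, hx, hγ⟩ => ⟨x, bot_le (a := K⟮y⟯) hx, hγ⟩
    rintro γ ⟨x, hx, hγ⟩
    obtain ⟨c, rfl⟩ := exists_eq_sum_of_mem_adjoin hp.ne_zero hfin hx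
    obtain ⟨j, -, hj⟩ := hens.exists_valuation_sum_eq hp.ne_zero hy hσ c
    exact mem_valueGroup_bot.2 ⟨c j, hj.symm.trans hγ⟩
  have hadj : residueExtension v K⟮y⟯ = k⟮res y'⟯ := by
    refine le_antisymm ?_ (adjoin_simple_le_iff.2
      ⟨y', mem_adjoin_simple_self K y, rfl⟩)
    rintro r ⟨⟨x, hx1⟩, hx, rfl⟩
    obtain ⟨c, rfl⟩ := exists_eq_sum_of_mem_adjoin hp.ne_zero hfin hx
    obtain ⟨j, hj, hj'⟩ := hens.exists_valuation_sum_eq hp.ne_zero hy hσ c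
    have hc (i) : v (algebraMap K Ω (c i)) ≤ 1 := (hj i).trans (hj'.symm.trans_le hx1)
    have hsum : (⟨_, hx1⟩ : v.valuationSubring) =
        ∑ j : Fin p, (⟨_, hc j⟩ : v.valuationSubring) * y' ^ (j : ℕ) := by
      apply Subtype.ext
      rw [AddSubmonoidClass.coe_finsetSum]
      rfl
    rw [hsum, map_sum]
    refine sum_mem fun i _ => ?_
    rw [map_mul, map_pow]
    exact mul_mem (IntermediateField.algebraMap_mem k⟮res y'⟯
      (⟨_, mem_residueField_bot.2 ⟨c i, hc i, rfl⟩⟩ : k)) (pow_mem (mem_adjoin_simple_self k _) _)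
  let r : k := ⟨res ⟨_, hb⟩, mem_residueField_bot.2 ⟨b, hb, rfl⟩⟩
  have hroot : aeval (res y') (X ^ p - X - C r) = 0 := by
    have h : res (y' ^ p - y' - ⟨_, hb⟩) = 0 :=
      (residue_eq_zero_iff_valuation_lt_one v _).2 hyb
    rw [map_sub, map_sub, map_pow] at h
    rw [map_sub, map_sub, map_pow, aeval_X, aeval_C]
    exact h
  have hdeg : (X ^ p - X - C r : k[X]).natDegree = p := by
    have h1 : (X ^ p - X : k[X]).natDegree = p :=
      natDegree_sub_eq_left_of_natDegree_lt (by simpa using hp.one_lt) |>.trans (natDegree_X_pow p)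
    rw [natDegree_sub_C, h1]
  have hne : (X ^ p - X - C r : k[X]) ≠ 0 := fun h => by
    rw [h, natDegree_zero] at hdeg
    exact hp.ne_zero hdeg.symm
  have hint : IsIntegral k (res y') := IsAlgebraic.isIntegral ⟨_, hne, hroot⟩
  have hsep : IsSeparable k (res y') :=
    (separable_X_pow_sub_X_sub_C p r).of_dvd (minpoly.dvd k _ hroot)
  -- A residual relation of degree less than p lifts to a small combination of powers of y, forcing
  -- all its coefficients to be small, whereas the leading one reduces to 1.
  have hmin : (minpoly k (res y')).natDegree = p := by
    refine le_antisymm (hdeg ▸ natDegree_le_of_dvd (minpoly.dvd k _ hroot) hne)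
      (not_lt.1 fun h => ?_)
    choose c hc hcr using fun i : ℕ =>
      mem_residueField_bot.1 ((minpoly k (res y')).coeff i).2
    have h0 := aeval_eq_sum_range' h (res y')
    rw [minpoly.aeval, Finset.sum_range] at h0
    have h1 : v (∑ j : Fin p, algebraMap K Ω (c j) * y ^ (j : ℕ)) < 1 := by
      have := (residue_eq_zero_iff_valuation_lt_one v
        (∑ j : Fin p, (⟨_, hc j⟩ : v.valuationSubring) * y' ^ (j : ℕ))).1 (by
          rw [map_sum, h0]
          refine Finset.sum_congr rfl fun j _ => ?_
          rw [map_mul, map_pow, hcr, Algebra.smul_def]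
          rfl)
      rw [AddSubmonoidClass.coe_finsetSum] at this
      exact this
    have h2 := hens.valuation_coeff_lt_one hy hσ (c := fun j => c j) (fun j => hc j) h1 ⟨_, h⟩
    have h3 := (residue_eq_zero_iff_valuation_lt_one v ⟨_, hc _⟩).2 h2
    rw [hcr, (minpoly.monic hint).coeff_natDegree] at h3
    exact one_ne_zero (Subtype.ext h3 : (1 : k) = 0)
  have hsepL : Algebra.IsSeparable k (residueExtension v K⟮y⟯) := by
    rw [hadj]
    exact (isSeparable_adjoin_simple_iff_isSeparable _ _).2 hsep
  have hram {E : IntermediateField K Ω} (hE : E ≤ K⟮y⟯) : ramificationIndex v E = 1 := by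
    refine Subgroup.relIndex_eq_one.2 (le_trans ?_ hval.le)
    exact fun γ ⟨x, hx, hγ⟩ => ⟨x, hE hx, hγ⟩
  refine ⟨⟨.of_finrank_pos (hfin ▸ hp.pos), ?_⟩, fun E hE _ => ⟨?_, ?_⟩, hval⟩
  · rw [hfin, hram le_rfl, one_mul, residueDegree, hadj, adjoin.finrank hint, hmin]
  · rw [hram hE]
    exact hp.one_lt.ne' ∘ Nat.dvd_one.1
  · have hle : residueExtension v E ≤ residueExtension v K⟮y⟯ :=
      fun r ⟨x, hx, hr⟩ => ⟨x, hE hx, hr⟩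
    exact Algebra.IsSeparable.of_algHom _ _ (IntermediateField.inclusion hle)

end Residues

/-! ### Degree and Galois property of Kummer extensions -/

section Kummer

variable {K Ω : Type*} [Field K] [Field Ω] [Algebra K Ω]

theorem finrank_adjoin_eq_of_minpoly {θ : Ω} {m : ℕ} (hm : m ≠ 0) {a : K}
    (hmin : minpoly K θ = X ^ m - C a) : Module.finrank K K⟮θ⟯ = m := by
  have hint : IsIntegral K θ := by
    by_contra h
    rw [minpoly.eq_zero h] at hmin
    exact (monic_X_pow_sub_C a hm).ne_zero hmin.symm
  rw [adjoin.finrank hint, hmin, natDegree_X_pow_sub_C]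

theorem isKummer_adjoin {p : ℕ} (hp : p.Prime) {ζ : K} (hζ : IsPrimitiveRoot ζ p)
    {θ : Ω} {a : K} (hmin : minpoly K θ = X ^ p - C a) : IsKummer p K⟮θ⟯ := by
  have hfin := finrank_adjoin_eq_of_minpoly hp.ne_zero hmin
  have : FiniteDimensional K K⟮θ⟯ := .of_finrank_pos (hfin ▸ hp.pos)
  have htfae := (isCyclic_tfae K K⟮θ⟯
    ⟨ζ, (mem_primitiveRoots (hfin ▸ hp.pos)).2 (hfin.symm ▸ hζ)⟩).out 0 2
  refine ⟨(htfae.2 ⟨AdjoinSimple.gen K θ, ⟨a, ?_⟩, ?_⟩).1, hfin, θ, a, rfl, hmin⟩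
  · apply Subtype.ext
    have h := minpoly.aeval K θ
    rw [hmin, map_sub, map_pow, aeval_X, aeval_C, sub_eq_zero] at h
    rw [hfin]
    exact h.symm
  · apply lift_injective
    rw [lift_adjoin_simple, lift_top]
    rfl

end Kummer

/-! ### Passing between Kummer and Artin-Schreier equations -/

section Approximation

variable {K Ω Γ : Type*} [Field K] [Field Ω] [Algebra K Ω]
  [LinearOrderedCommGroupWithZero Γ] {v : Valuation Ω Γ} {p : ℕ} {ζ : K}

theorem valuation_aeval_lt_one {G : K[X]} (hG : ∀ i, v (algebraMap K Ω (G.coeff i)) < 1) {y : Ω}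
    (hy : v y ≤ 1) : v (aeval y G) < 1 := by
  rw [aeval_eq_sum_range]
  refine v.map_sum_lt one_ne_zero fun i _ => ?_
  rw [Algebra.smul_def, map_mul, map_pow]
  exact mul_lt_one_of_lt_of_le (hG i) (pow_le_one' hy i)

theorem exists_polynomial_one_add_mul_pow [CharZero K] (hp : p.Prime) (hζ : IsPrimitiveRoot ζ p)
    (hvp : v (p : Ω) < 1) :
    ∃ G : K[X], (∀ i, v (algebraMap K Ω (G.coeff i)) < 1) ∧ G.degree < p ∧ ∀ y : Ω,
      (1 + algebraMap K Ω (ζ - 1) * y) ^ p =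
        1 + algebraMap K Ω (ζ - 1) ^ p * (y ^ p - y + aeval y G) :=
  exists_polynomial_one_add_root_sub_one_mul_pow (w := v.comap (algebraMap K Ω)) hp hζ
    (by simpa using hvp) (Nat.cast_ne_zero.2 hp.ne_zero) Ω

theorem valuation_pow_prime_sub_one_le [CharZero K] (hp : p.Prime) (hζ : IsPrimitiveRoot ζ p)
    (hvp : v (p : Ω) < 1) {x : Ω} (hx : v (x - 1) ≤ v (algebraMap K Ω (ζ - 1))) :
    v (x ^ p - 1) ≤ v (algebraMap K Ω (ζ - 1)) ^ p := by
  obtain ⟨G, hG, -, hGy⟩ := exists_polynomial_one_add_mul_pow hp hζ hvp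
  set π := algebraMap K Ω (ζ - 1)
  have hπ : π ≠ 0 := (_root_.map_ne_zero _).2 (sub_ne_zero.2 (hζ.ne_one hp.one_lt))
  have hvπ : 0 < v π := zero_lt_iff.2 (v.ne_zero_iff.2 hπ)
  have hy : v ((x - 1) / π) ≤ 1 := by
    rw [map_div₀]; exact (div_le_one₀ hvπ).2 hx
  have h := hGy ((x - 1) / π)
  rw [mul_div_cancel₀ _ hπ, add_sub_cancel] at h
  rw [h, add_sub_cancel_left, map_mul, map_pow]
  refine mul_le_of_le_one_right' (v.map_add_le (v.map_sub_le ?_ hy)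
    (valuation_aeval_lt_one hG hy).le)
  rw [map_pow]
  exact pow_le_one' hy p

/-- A Kummer generator at distance at most `v (ζ - 1)` from `K` generates an unramified
defectless extension. -/
theorem IsHenselianOn.isDefectless_and_isUnramified_of_valuation_sub_le [CharZero K]
    [IsAlgClosure K Ω] (hens : IsHenselianOn K v) (hp : p.Prime)
    [CharP (residueField v (⊥ : IntermediateField K Ω)) p]
    (hζ : IsPrimitiveRoot ζ p) {η : Ω} {a : K} (hη : v η = 1)
    (hmin : minpoly K η = X ^ p - C a) {c : K}
    (hc : v (η - algebraMap K Ω c) ≤ v (algebraMap K Ω ζ - 1)) :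
    IsDefectless v K⟮η⟯ ∧ IsUnramified p v K⟮η⟯ := by
  have hchar : CharP (IsLocalRing.ResidueField v.valuationSubring) p :=
    charP_residueField_valuationSubring (K := K)
  have hvp : v (p : Ω) < 1 := valuation_natCast_lt_one
  have hζ' := hζ.map_of_injective (algebraMap K Ω).injective
  obtain ⟨σ, hσ⟩ := exists_algEquiv_apply_eq_root_mul hmin hζ.pow_eq_one
  obtain ⟨G, hG, -, hGy⟩ := exists_polynomial_one_add_mul_pow hp hζ hvp
  have hδ := valuation_root_sub_one_lt_one (w := v) hp hζ' hvp
  have hπ : algebraMap K Ω (ζ - 1) ≠ 0 :=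
    (_root_.map_ne_zero _).2 (sub_ne_zero.2 (hζ.ne_one hp.one_lt))
  have hπz : algebraMap K Ω (ζ - 1) = algebraMap K Ω ζ - 1 := by simp
  have hzi (i : ℕ) : v (algebraMap K Ω ζ ^ i - 1) ≤ v (algebraMap K Ω ζ - 1) :=
    valuation_pow_sub_one_le
      (valuation_eq_one_of_pow_eq_one hp.ne_zero hζ'.pow_eq_one).le i
  have hηa : η ^ p = algebraMap K Ω a := by
    have h := minpoly.aeval K η
    rwa [hmin, map_sub, map_pow, aeval_X, aeval_C, sub_eq_zero] at h
  have hvc : v (algebraMap K Ω c) = 1 := by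
    have := v.map_sub_eq_of_lt_left (hc.trans_lt (hδ.trans_eq hη.symm))
    rwa [sub_sub_cancel, hη] at this
  have hc0 : algebraMap K Ω c ≠ 0 := v.ne_zero_iff.1 (by rw [hvc]; exact one_ne_zero)
  set π := algebraMap K Ω (ζ - 1) with hπdef
  have hvπ : 0 < v π := zero_lt_iff.2 (v.ne_zero_iff.2 hπ)
  set x := η / algebraMap K Ω c with hx
  have hx1 : v (x - 1) ≤ v π := by
    rw [hx, div_sub_one hc0, map_div₀, hvc, div_one, hπz]
    exact hc
  have hvx : v x = 1 := by rw [hx, map_div₀, hη, hvc, div_one]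
  set y := (x - 1) / π with hy
  have hxy : 1 + π * y = x := by rw [hy, mul_div_cancel₀ _ hπ, add_sub_cancel]
  have hvy : v y ≤ 1 := by rw [hy, map_div₀]; exact (div_le_one₀ hvπ).2 hx1
  have hadj : K⟮y⟯ = K⟮η⟯ := by
    refine le_antisymm (adjoin_simple_le_iff.2 ?_) (adjoin_simple_le_iff.2 ?_)
    · exact div_mem (sub_mem (div_mem (mem_adjoin_simple_self K η)
        (IntermediateField.algebraMap_mem _ _)) (one_mem _)) (IntermediateField.algebraMap_mem _ _)
    · have hηx : η = (1 + π * y) * algebraMap K Ω c := by rw [hxy, hx, div_mul_cancel₀ _ hc0]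
      rw [hηx]
      exact mul_mem (add_mem (one_mem _) (mul_mem (IntermediateField.algebraMap_mem _ _)
        (mem_adjoin_simple_self K y))) (IntermediateField.algebraMap_mem _ _)
  have hσy (i : ℕ) : (σ ^ i) y = (algebraMap K Ω ζ ^ i * x - 1) / π := by
    rw [hy, hx, map_div₀, map_sub, map_div₀, pow_apply_eq_root_pow_mul hσ, AlgEquiv.commutes,
      map_one, hπdef, AlgEquiv.commutes, mul_div_assoc]
  -- Each further application of σ adds ζ^i x to y, and this is congruent to 1.
  have hconj (i : ℕ) : v ((σ ^ i) y - (y + i)) < 1 := by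
    induction i with
    | zero => simp
    | succ i ih =>
      have h : (σ ^ (i + 1)) y - (y + (i + 1 : ℕ)) =
          ((σ ^ i) y - (y + i)) + ((algebraMap K Ω ζ ^ i - 1) * x + (x - 1)) := by
        rw [hσy, hσy, Nat.cast_succ]
        field_simp
        rw [hπz]
        ring
      rw [h]
      refine v.map_add_lt ih (v.map_add_lt ?_ ?_)
      · rw [map_mul, hvx, mul_one]
        exact (hzi i).trans_lt hδ
      · exact hx1.trans_lt (hπz ▸ hδ)
  have hb : algebraMap K Ω ((a / c ^ p - 1) / (ζ - 1) ^ p) = y ^ p - y + aeval y G := by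
    have h := hGy y
    rw [hxy, hx, div_pow, hηa] at h
    rw [map_div₀, map_sub, map_div₀, map_pow, map_pow, map_one, h, add_sub_cancel_left,
      mul_div_cancel_left₀ _ (pow_ne_zero _ hπ)]
  have hGlt := valuation_aeval_lt_one hG hvy
  have hvyp : v (y ^ p) ≤ 1 := by rw [map_pow]; exact pow_le_one' hvy p
  rw [← hadj]
  refine hens.isDefectless_and_isUnramified hp hvy hconj
    (hadj ▸ finrank_adjoin_eq_of_minpoly hp.ne_zero hmin)
    (b := (a / c ^ p - 1) / (ζ - 1) ^ p) ?_ ?_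
  · rw [hb]
    exact v.map_add_le (v.map_sub_le hvyp hvy) hGlt.le
  · rw [hb, sub_add_cancel_left, v.map_neg]
    exact hGlt

/-- A residue extension that is both separable and purely inseparable is trivial; with no
ramification and no defect the degree would be 1. -/
theorem not_isPurelyWild_of_isUnramified {L : IntermediateField K Ω}
    (hL : IsDefectless v L ∧ IsUnramified p v L) (hne : Module.finrank K L ≠ 1) :
    ¬ IsPurelyWild p v L := by
  intro h
  obtain ⟨⟨hfd, hdef⟩, hun, hval⟩ := hL
  have := h.2
  have := (hun L le_rfl hfd).2
  apply hne
  have hram : ramificationIndex v L = 1 := Subgroup.relIndex_eq_one.2 hval.le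
  have hsurj := IsPurelyInseparable.surjective_algebraMap_of_isSeparable
    (residueField v (⊥ : IntermediateField K Ω)) (residueExtension v L)
  rw [hdef, hram, one_mul, residueDegree, finrank_eq_one_iff_of_nonzero' 1 one_ne_zero]
  intro w
  obtain ⟨c, rfl⟩ := hsurj w
  exact ⟨c, (Algebra.algebraMap_eq_smul_one c).symm⟩

/-- A residual Artin-Schreier root can be lifted to the generator of a Kummer extension. -/
theorem exists_lift_artinSchreier [CharZero K] [IsAlgClosure K Ω] (hp : p.Prime)
    (hζ : IsPrimitiveRoot ζ p) (hvp : v (p : Ω) < 1) {b : K} (hb : v (algebraMap K Ω b) ≤ 1) :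
    ∃ y : Ω, v y ≤ 1 ∧ v (y ^ p - y - algebraMap K Ω b) < 1 ∧
      (1 + algebraMap K Ω (ζ - 1) * y) ^ p ∈ (algebraMap K Ω).range := by
  have := IsAlgClosure.isAlgClosed K (K := Ω)
  obtain ⟨G, hG, hdeg, hGy⟩ := exists_polynomial_one_add_mul_pow hp hζ hvp
  have hd : (X ^ p + (G - X - C b) : K[X]).degree = p := by
    have h1 : (1 : WithBot ℕ) < p := by exact_mod_cast hp.one_lt
    have h0 : (0 : WithBot ℕ) < p := by exact_mod_cast hp.pos
    have h2 : (G - X - C b : K[X]).degree < (X ^ p : K[X]).degree := by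
      rw [degree_X_pow]
      refine (degree_sub_le _ _).trans_lt (max_lt ((degree_sub_le _ _).trans_lt
        (max_lt hdeg ?_)) (degree_C_le.trans_lt h0))
      rwa [degree_X]
    rw [degree_add_eq_left_of_degree_lt h2, degree_X_pow]
  -- The correction `G` is kept in the equation so that (1 + πy)^p equals 1 + π^p b exactly and
  -- hence lies in K.
  obtain ⟨y, hy⟩ := IsAlgClosed.exists_aeval_eq_zero Ω (X ^ p + (G - X - C b) : K[X])
    (by rw [hd]; exact_mod_cast hp.ne_zero)
  rw [map_add, map_sub, map_sub, map_pow, aeval_X, aeval_C] at hy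
  have hvy : v y ≤ 1 := by
    by_contra! hlt
    have h1 : y ^ p = y - aeval y G + algebraMap K Ω b := by linear_combination hy
    have h2 : v (y ^ p) ≤ v y ^ (p - 1) := by
      have h3 : 1 ≤ v y ^ (p - 1) := one_le_pow_of_one_le' hlt.le _
      rw [h1]
      refine v.map_add_le (v.map_sub_le (le_self_pow hlt.le ?_) ?_) (hb.trans h3)
      · have := hp.two_le; omega
      · rw [aeval_eq_sum_range]
        refine v.map_sum_le fun i hi => ?_
        rw [Algebra.smul_def, map_mul, map_pow]
        refine (mul_le_of_le_one_left' (hG i).le).trans (pow_le_pow_right' hlt.le ?_)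
        have h4 := Finset.mem_range.1 hi
        have h5 : G.natDegree < p := by
          rcases eq_or_ne G 0 with rfl | hG0
          · simpa using hp.pos
          · exact (natDegree_lt_iff_degree_lt hG0).2 hdeg
        omega
    rw [map_pow] at h2
    have := hp.pos
    exact h2.not_gt (pow_lt_pow_right₀ hlt (by omega))
  refine ⟨y, hvy, ?_, 1 + (ζ - 1) ^ p * b, ?_⟩
  · rw [show y ^ p - y - algebraMap K Ω b = -aeval y G by linear_combination hy, v.map_neg]
    exact valuation_aeval_lt_one hG hvy
  · rw [hGy, map_add, map_one, map_mul, map_pow]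
    congr 2
    linear_combination -hy

/-- A purely wild extension contains no lift of a root of an irreducible Artin-Schreier
polynomial. -/
theorem not_mem_of_isPurelyWild (hp : p.Prime)
    [CharP (residueField v (⊥ : IntermediateField K Ω)) p] {L : IntermediateField K Ω}
    (hL : IsPurelyWild p v L) {b : K} (hb : v (algebraMap K Ω b) ≤ 1)
    (hirr : Irreducible (X ^ p - X - C ⟨_, mem_residueField_bot.2 ⟨b, hb, rfl⟩⟩ :
      (residueField v (⊥ : IntermediateField K Ω))[X]))
    {y : Ω} (hy : v y ≤ 1) (hyb : v (y ^ p - y - algebraMap K Ω b) < 1) : y ∉ L := by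
  intro hyL
  let y' : v.valuationSubring := ⟨y, hy⟩
  let k := residueField v (⊥ : IntermediateField K Ω)
  let r : k := ⟨_, mem_residueField_bot.2 ⟨b, hb, rfl⟩⟩
  let s : residueExtension v L := ⟨IsLocalRing.residue _ y', y', hyL, rfl⟩
  have hroot : aeval s (X ^ p - X - C r) = 0 := by
    have h : IsLocalRing.residue v.valuationSubring (y' ^ p - y' - ⟨_, hb⟩) = 0 :=
      (residue_eq_zero_iff_valuation_lt_one v _).2 hyb
    rw [map_sub, map_sub, map_pow] at h
    rw [map_sub, map_sub, map_pow, aeval_X, aeval_C]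
    exact Subtype.ext h
  have hsep : IsSeparable k s :=
    (separable_X_pow_sub_X_sub_C p r).of_dvd (minpoly.dvd k _ hroot)
  -- The residue of y is separable over the residue field of K, so pure inseparability puts it
  -- there, giving an irreducible polynomial of degree p a root.
  obtain ⟨t, ht⟩ := hL.2.inseparable' s hsep
  rw [← ht, aeval_algebraMap_apply, map_eq_zero_iff _ (algebraMap k _).injective,
    coe_aeval_eq_eval] at hroot
  have h1 := natDegree_eq_of_degree_eq_some (degree_eq_one_of_irreducible_of_root hirr hroot)
  have h2 : (X ^ p - X - C r : k[X]).natDegree = p := by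
    rw [natDegree_sub_C, natDegree_sub_eq_left_of_natDegree_lt (by simpa using hp.one_lt),
      natDegree_X_pow]
  exact hp.one_lt.ne' (h2.symm.trans h1)

end Approximation

/-! ### The case n ≥ 2 and the two maximal extensions -/

section Main

variable {K Ω Γ : Type*} [Field K] [CharZero K] [Field Ω] [Algebra K Ω] [IsAlgClosure K Ω]
  [LinearOrderedCommGroupWithZero Γ] {v : Valuation Ω Γ} {p : ℕ} {ζ : K}

/-- Taking p-th powers improves an approximation of quality δ to δ^p, and further powers do not
spoil it. For n ≥ 2 the Kummer generator θ^(p^(n-1)) would then be closer to K than δ. -/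
theorem exponent_eq_one_of_valuation_sub_le (hens : IsHenselianOn K v) (hp : p.Prime)
    (hζ : IsPrimitiveRoot ζ p) (hvp : v (p : Ω) < 1) {n : ℕ} (hn : 1 ≤ n) {a : K} {θ : Ω}
    (hmin : minpoly K θ = X ^ p ^ n - C a) (hval : v θ = 1) {c : K}
    (hc : v (θ - algebraMap K Ω c) ≤ v (algebraMap K Ω ζ - 1)) : n = 1 := by
  by_contra hne
  obtain ⟨m, rfl⟩ : ∃ m, n = m + 1 + 1 := ⟨n - 2, by omega⟩
  have hmin' := minpoly_pow_eq_X_pow_sub_C hp hζ hmin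
  obtain ⟨σ, hσ⟩ := exists_algEquiv_apply_eq_root_mul hmin' hζ.pow_eq_one
  have hζ' := hζ.map_of_injective (algebraMap K Ω).injective
  have hδ := valuation_root_sub_one_lt_one (w := v) hp hζ' hvp
  have hδ0 : 0 < v (algebraMap K Ω ζ - 1) :=
    zero_lt_iff.2 (v.ne_zero_iff.2 (sub_ne_zero.2 (hζ'.ne_one hp.one_lt)))
  have hπz : algebraMap K Ω (ζ - 1) = algebraMap K Ω ζ - 1 := by simp
  have hvc : v (algebraMap K Ω c) = 1 := by
    have := v.map_sub_eq_of_lt_left (hc.trans_lt (hδ.trans_eq hval.symm))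
    rwa [sub_sub_cancel, hval] at this
  have hc0 : algebraMap K Ω c ≠ 0 := v.ne_zero_iff.1 (by rw [hvc]; exact one_ne_zero)
  have hle : v (algebraMap K Ω ζ - 1) ^ p ≤ v (algebraMap K Ω ζ - 1) :=
    pow_le_of_le_one zero_le hδ.le hp.ne_zero
  have hpow (j : ℕ) : v ((θ / algebraMap K Ω c) ^ p ^ (j + 1) - 1) ≤
      v (algebraMap K Ω ζ - 1) ^ p := by
    rw [← hπz] at hc hle ⊢
    induction j with
    | zero =>
      rw [zero_add, pow_one]
      refine valuation_pow_prime_sub_one_le hp hζ hvp ?_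
      rwa [div_sub_one hc0, map_div₀, hvc, div_one]
    | succ j ih =>
      rw [pow_succ p, pow_mul]
      exact valuation_pow_prime_sub_one_le hp hζ hvp (ih.trans hle)
  have h1 := hens.root_sub_one_le (by rw [map_pow, hval, one_pow]) hσ (c ^ p ^ (m + 1))
  have h2 := hpow m
  rw [div_pow, div_sub_one (pow_ne_zero _ hc0), map_div₀, map_pow v (algebraMap K Ω c), hvc,
    one_pow, div_one] at h2
  rw [map_pow] at h1
  refine (h1.trans h2).not_gt ?_
  exact pow_lt_self_of_lt_one₀ hδ0 hδ hp.one_lt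

/-- A purely wild Kummer extension generated by an element of value one gives rise to two
nonisomorphic maximal purely wild extensions. -/
theorem exists_isMaximalPurelyWild_isEmpty_algEquiv (hens : IsHenselianOn K v) (hp : p.Prime)
    [CharP (residueField v (⊥ : IntermediateField K Ω)) p]
    (hζ : IsPrimitiveRoot ζ p) {a : K} {θ : Ω} (hmin : minpoly K θ = X ^ p - C a)
    (hval : v θ = 1) (hpw : IsPurelyWild p v K⟮θ⟯)
    (hAS : ¬ IsArtinSchreierClosed p (residueField v (⊥ : IntermediateField K Ω))) :
    ∃ L L' : IntermediateField K Ω,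
      IsMaximalPurelyWild p v L ∧ IsMaximalPurelyWild p v L' ∧ IsEmpty (L ≃ₐ[K] L') := by
  have : CharP (IsLocalRing.ResidueField v.valuationSubring) p :=
    charP_residueField_valuationSubring (K := K)
  have : NeZero p := ⟨hp.ne_zero⟩
  have hvp : v (p : Ω) < 1 := valuation_natCast_lt_one
  have hζ' := hζ.map_of_injective (algebraMap K Ω).injective
  have hδ := valuation_root_sub_one_lt_one (w := v) hp hζ' hvp
  have hπz : algebraMap K Ω (ζ - 1) = algebraMap K Ω ζ - 1 := by simp
  have hπ : algebraMap K Ω (ζ - 1) ≠ 0 :=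
    (_root_.map_ne_zero _).2 (sub_ne_zero.2 (hζ.ne_one hp.one_lt))
  have hθ0 : θ ≠ 0 := v.ne_zero_iff.1 (by rw [hval]; exact one_ne_zero)
  have hθa : θ ^ p = algebraMap K Ω a := by
    have h := minpoly.aeval K θ
    rwa [hmin, map_sub, map_pow, aeval_X, aeval_C, sub_eq_zero] at h
  simp only [IsArtinSchreierClosed, not_forall, not_not] at hAS
  obtain ⟨⟨r, hr⟩, hirr⟩ := hAS
  obtain ⟨b, hb, rfl⟩ := mem_residueField_bot.1 hr
  obtain ⟨y, hvy, hyb, d, hd⟩ := exists_lift_artinSchreier hp hζ hvp hb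
  set η := 1 + algebraMap K Ω (ζ - 1) * y with hη
  have hηW {W : IntermediateField K Ω} (hW : IsPurelyWild p v W) : η ∉ W := fun h => by
    refine not_mem_of_isPurelyWild hp hW hb hirr hvy hyb ?_
    have : y = (η - 1) / algebraMap K Ω (ζ - 1) := by
      rw [hη, add_sub_cancel_left, mul_div_cancel_left₀ _ hπ]
    rw [this]
    exact div_mem (sub_mem h (one_mem _)) (IntermediateField.algebraMap_mem _ _)
  have hdist : v (η - 1) ≤ v (algebraMap K Ω ζ - 1) := by
    rw [hη, add_sub_cancel_left, map_mul, hπz]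
    exact mul_le_of_le_one_right' hvy
  have hvη : v η = 1 := by
    have := v.map_add_eq_of_lt_right (x := η - 1) (y := 1)
      (by rw [map_one]; exact hdist.trans_lt hδ)
    rwa [sub_add_cancel, map_one] at this
  have hηθ {W : IntermediateField K Ω} (h1 : θ ∈ W) (h2 : θ * η ∈ W) : η ∈ W := by
    have := div_mem h2 h1
    rwa [mul_div_cancel_left₀ _ hθ0] at this
  have hmin' : minpoly K (θ * η) = X ^ p - C (a * d) := by
    refine minpoly_eq_X_pow_sub_C hp hζ (by rw [mul_pow, hθa, ← hd, map_mul]) fun ⟨c, hc⟩ => ?_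
    exact hηW hpw (hηθ (mem_adjoin_simple_self K θ)
      (hc ▸ IntermediateField.algebraMap_mem K⟮θ⟯ c))
  -- Since θη differs from θ by at most δ, a c within δ of θη is within δ of θ, which would make
  -- K(θ) unramified and defectless.
  have hfar (c : K) : v (algebraMap K Ω ζ - 1) < v (θ * η - algebraMap K Ω c) := by
    by_contra! hc
    refine not_isPurelyWild_of_isUnramified
      (hens.isDefectless_and_isUnramified_of_valuation_sub_le hp hζ hval hmin (c := c) ?_) ?_ hpw
    · rw [show θ - algebraMap K Ω c = (θ * η - algebraMap K Ω c) - θ * (η - 1) by ring]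
      refine v.map_sub_le hc ?_
      rwa [map_mul, hval, one_mul]
    · rw [finrank_adjoin_eq_of_minpoly hp.ne_zero hmin]
      exact hp.one_lt.ne'
  obtain ⟨σ, hσ⟩ := exists_algEquiv_apply_eq_root_mul hmin' hζ.pow_eq_one
  have hpw' : IsPurelyWild p v K⟮θ * η⟯ :=
    hens.isPurelyWild_of_forall_lt hp hζ hvp (by rw [map_mul, hval, hvη, one_mul])
      (finrank_adjoin_eq_of_minpoly hp.ne_zero hmin') hσ hfar
  obtain ⟨L, hL, hLmax⟩ := hpw.exists_isMaximalPurelyWild hp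
  obtain ⟨L', hL', hLmax'⟩ := hpw'.exists_isMaximalPurelyWild hp
  refine ⟨L, L', hLmax, hLmax', ⟨fun f => hηW hLmax'.1 (hηθ ?_
    (hL' (mem_adjoin_simple_self K _)))⟩⟩
  let t : L' := f ⟨θ, hL (mem_adjoin_simple_self K θ)⟩
  have ht : (t : Ω) ^ p = algebraMap K Ω a := by
    have h1 : (⟨θ, hL (mem_adjoin_simple_self K θ)⟩ : L) ^ p = algebraMap K L a :=
      Subtype.ext hθa
    have h2 : t ^ p = algebraMap K L' a := by
      rw [← map_pow, h1, f.commutes]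
    exact congrArg Subtype.val h2
  have ht0 : (t : Ω) ≠ 0 := fun h => by
    rw [h, ← hθa, zero_pow hp.ne_zero] at ht
    exact pow_ne_zero p hθ0 ht.symm
  -- The isomorphism carries θ to another p-th root of `a`; as K contains ζ, θ itself then lies in
  -- `L'`.
  obtain ⟨i, -, hi⟩ := hζ'.eq_pow_of_pow_eq_one (ξ := θ / t) (by
    rw [div_pow, hθa, ht, div_self (ht ▸ pow_ne_zero p ht0)])
  rw [← div_mul_cancel₀ θ ht0, ← hi, ← map_pow]
  exact mul_mem (IntermediateField.algebraMap_mem _ _) t.2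

end Main

end PurelyWild

theorem corollary3p14 {K Ω Γ : Type*} [Field K] [CharZero K] [Field Ω] [Algebra K Ω]
    [IsAlgClosure K Ω] [LinearOrderedCommGroupWithZero Γ] (v : Valuation Ω Γ)
    (hens : PurelyWild.IsHenselianOn K v)
    (p : ℕ) (hp : p.Prime)
    (hchar : CharP (PurelyWild.residueField v (⊥ : IntermediateField K Ω)) p)
    (hroot : ∃ ζ : K, IsPrimitiveRoot ζ p)
    (n : ℕ) (hn : 1 ≤ n) (a : K) (θ : Ω)
    (hmin : minpoly K θ = Polynomial.X ^ p ^ n - Polynomial.C a)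
    (hval : v θ = 1) :
    -- `δ` is the value `νp / (p - 1)`, written multiplicatively
    (∃ δ : Γ, δ ^ (p - 1) = v (p : Ω) ∧
      (∀ γ ∈ PurelyWild.valueSet K v θ, δ ≤ γ) ∧
      (δ ∈ PurelyWild.valueSet K v θ ↔
        PurelyWild.IsDefectless v (IntermediateField.adjoin K {θ}) ∧
        PurelyWild.IsUnramified p v (IntermediateField.adjoin K {θ}) ∧
        PurelyWild.IsKummer p (IntermediateField.adjoin K {θ}))) ∧
    (PurelyWild.IsPurelyWild p v (IntermediateField.adjoin K {θ}) →
      ¬ PurelyWild.IsArtinSchreierClosed p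
        (PurelyWild.residueField v (⊥ : IntermediateField K Ω)) →
      ∃ L L' : IntermediateField K Ω,
        PurelyWild.IsMaximalPurelyWild p v L ∧ PurelyWild.IsMaximalPurelyWild p v L' ∧
          IsEmpty (L ≃ₐ[K] L')) := by
  obtain ⟨ζ, hζ⟩ := hroot
  have : CharP (IsLocalRing.ResidueField v.valuationSubring) p :=
    PurelyWild.charP_residueField_valuationSubring (K := K)
  have : CharZero Ω := charZero_of_injective_algebraMap (algebraMap K Ω).injective
  have hvp : v (p : Ω) < 1 := PurelyWild.valuation_natCast_lt_one
  have hζ' := hζ.map_of_injective (algebraMap K Ω).injective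
  obtain ⟨σ, hσ⟩ := PurelyWild.exists_algEquiv_apply_eq_root_mul (z := ζ) hmin
    (by rw [← Nat.sub_add_cancel hn, pow_succ', pow_mul, hζ.pow_eq_one, one_pow])
  have hlow := hens.root_sub_one_le hval hσ
  refine ⟨⟨v (algebraMap K Ω ζ - 1), ?_, ?_, ?_, ?_⟩, fun hpw hAS => ?_⟩
  · exact PurelyWild.valuation_root_sub_one_pow hp hζ' hvp (Nat.cast_ne_zero.2 hp.ne_zero)
  · rintro γ ⟨c, rfl⟩
    exact hlow c
  · rintro ⟨c, hc⟩
    obtain rfl := PurelyWild.exponent_eq_one_of_valuation_sub_le hens hp hζ hvp hn hmin hval hc.le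
    rw [pow_one] at hmin
    obtain ⟨hdef, hun⟩ :=
      hens.isDefectless_and_isUnramified_of_valuation_sub_le hp hζ hval hmin hc.le
    exact ⟨hdef, hun, PurelyWild.isKummer_adjoin hp hζ hmin⟩
  · rintro ⟨hdef, hun, -, hfin, -⟩
    -- If δ is not attained, every distance exceeds δ, which makes K(θ) purely wild.
    by_contra hnot
    refine PurelyWild.not_isPurelyWild_of_isUnramified ⟨hdef, hun⟩
      (hfin.trans_ne hp.one_lt.ne') ?_
    exact hens.isPurelyWild_of_forall_lt hp hζ hvp hval hfin hσ fun c =>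
      lt_of_le_of_ne (hlow c) fun h => hnot ⟨c, h.symm⟩
  · obtain ⟨m, rfl⟩ : ∃ m, n = m + 1 := ⟨n - 1, by omega⟩
    refine PurelyWild.exists_isMaximalPurelyWild_isEmpty_algEquiv hens hp hζ
      (PurelyWild.minpoly_pow_eq_X_pow_sub_C hp hζ hmin) (by rw [map_pow, hval, one_pow])
      (hpw.mono hp (IntermediateField.adjoin_simple_le_iff.2 (pow_mem
        (IntermediateField.mem_adjoin_simple_self K θ) _))) hAS
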